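/- Let $\Sigma$ be a compact Riemann surface with canonical bundle $\mathcal K$, let $A\subset\Sigma$ be a finite set, and fix a theta characteristic, i.e. a holomorphic line bundle $L$ with $L^{\otimes 2}=\mathcal K$. For $\lambda\in\frac12\mathbb Z$ let $\mathcal F^\lambda$ be the space of global meromorphic sections of $\mathcal K^\lambda:=L^{\otimes 2\lambda}$ that are holomorphic on $\Sigma\setminus A$; sections are written locally as $f\,dz^\lambda$ and identified with their local representing functions $f$ (the prime denotes $d/dz$). Put $\mathcal L=\mathcal F^{-1}$ (vector fields) and $\mathcal S=\mathcal L\oplus\mathcal F^{-1/2}$, where $\mathcal S_{\bar 0}=\mathcal L$ is the even part and $\mathcal S_{\bar 1}=\mathcal F^{-1/2}$ the odd part, with the bilinear bracket $$[(e,\varphi),(f,\psi)]=\bigl([e,f]+\varphi\psi,\; e.\psi-f.\varphi\bigr),\qquad [e,f]=ef'-fe',\qquad e.\psi=e\psi'-\tfrac12\psi e'.$$ A holomorphic projective connection $R$ is a system of holomorphic functions $R_\alpha$, one for each coordinate $z_\alpha$ of a covering of $\Sigma$ by holomorphic coordinates, such that, for the coordinate changes $z_\beta=h(z_\alpha)$,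 $$R_\beta(z_\beta)\,(h')^2=R_\alpha(z_\alpha)+\frac{h'''}{h'}-\frac32\Bigl(\frac{h''}{h'}\Bigr)^2 .$$ Let $C$ be any closed continuously differentiable curve on $\Sigma$ (possibly with finitely many components) not meeting $A$, and let $R$ be any holomorphic projective connection. For $e,f\in\mathcal L$ and $\varphi,\psi\in\mathcal F^{-1/2}$ the local expressions $\bigl(\frac12(e'''f-ef''')-R(e'f-ef')\bigr)dz$ and $(\varphi''\psi+\varphi\psi''-R\varphi\psi)\,dz$ are well-defined meromorphic differentials on $\Sigma$, holomorphic outside of $A$. Let $\Phi_{C,R}:\mathcal S\times\mathcal S\to\mathbb C$ be the bilinear extension of $$\Phi_{C,R}(e,f)=\frac1{2\pi i}\int_C\Bigl(\tfrac12(e'''f-ef''')-R\,(e'f-ef')\Bigr)dz,$$ $$\Phi_{C,R}(\varphi,\psi)=-\frac1{2\pi i}\int_C\bigl(\varphi''\psi+\varphi\psi''-R\,\varphi\psi\bigr)dz,\qquad \Phi_{C,R}(e,\varphi)=\Phi_{C,R}(\varphi,e)=0 .$$ Then: 1. $\Phi_{C,R}$ is an even Lie superalgebra 2-cocycle for $\mathcal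 S$: it is bilinear, vanishes on pairs of elements of different parity, and for homogeneous $x,y,z$ of parities $\bar x,\bar y,\bar z$ it satisfies $\Phi(x,y)=-(-1)^{\bar x\bar y}\Phi(y,x)$ and $$(-1)^{\bar x\bar z}\Phi(x,[y,z])+(-1)^{\bar y\bar x}\Phi(y,[z,x])+(-1)^{\bar z\bar y}\Phi(z,[x,y])=0 .$$ 2. Hence it defines a central extension of $\mathcal S$: $\mathcal S$ is a Lie superalgebra, and $\mathbb C\oplus\mathcal S$, with $\mathbb C$ even and the bracket $[(a,x),(b,y)]=(\Phi_{C,R}(x,y),[x,y])$, is a Lie superalgebra which is a central extension of $\mathcal S$ by $\mathbb C$. 3. If $R'$ is another holomorphic projective connection, then $\Phi_{C,R'}$ and $\Phi_{C,R}$ are cohomologous: there is a linear form $\eta:\mathcal S\to\mathbb C$, vanishing on $\mathcal S_{\bar 1}$, with $\Phi_{C,R'}(x,y)-\Phi_{C,R}(x,y)=\eta([x,y])$ for all $x,y\in\mathcal S$. -/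

import Mathlib

open scoped Manifold ContDiff Topology

noncomputable section

namespace KN

/-! ### Riemann surfaces: coordinate coverings, theta characteristics, forms -/

/-- A covering of the Riemann surface `X` by holomorphic coordinates `(U_i, z_i)`. -/
structure CoordCover (X : Type*) [TopologicalSpace X] [ChartedSpace ℂ X] (ι : Type*) where
  /-- the local coordinate `z_i`, with domain `U_i = (chart i).source` -/
  chart : ι → OpenPartialHomeomorph X ℂ
  mem_maximalAtlas : ∀ i, chart i ∈ IsManifold.maximalAtlas 𝓘(ℂ) ω X
  exists_mem_source : ∀ p, ∃ i, p ∈ (chart i).source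

section Basic

variable {X : Type*} [TopologicalSpace X] [ChartedSpace ℂ X] {ι : Type*}

/-- The coordinate change `z_j = f_{ji}(z_i)`, defined on `z_i (U_i ∩ U_j)`. -/
def CoordCover.trans (U : CoordCover X ι) (i j : ι) : OpenPartialHomeomorph ℂ ℂ :=
  (U.chart i).symm.trans (U.chart j)

/-- The image of `U_i \ A` under the coordinate `z_i`. -/
def CoordCover.punctured (U : CoordCover X ι) (A : Finset X) (i : ι) : Set ℂ :=
  (U.chart i).target ∩ (U.chart i).symm ⁻¹' (A : Set X)ᶜ

/-- A theta characteristic, i.e. a holomorphic line bundle `L` with `L ⊗ L = K` (`K` the canonical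
bundle), given by its transition functions: `L` has on `U_i` a local generator whose square
is `dz_i`, and `g i j`, a function of the coordinate `z_i` on `z_i (U_i ∩ U_j)`, is the corresponding
holomorphic square root of `dz_j / dz_i`. -/
structure ThetaChar (U : CoordCover X ι) where
  g : ι → ι → ℂ → ℂ
  holo : ∀ i j, DifferentiableOn ℂ (g i j) (U.trans i j).source
  sq : ∀ i j, ∀ z ∈ (U.trans i j).source, g i j z ^ 2 = deriv (U.trans i j) z
  cocycle : ∀ i j k, ∀ z ∈ (U.trans i j).source, z ∈ (U.trans i k).source →
    g i k z = g i j z * g j k (U.trans i j z)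

/-- The space of meromorphic forms of weight `k / 2`, i.e. of global meromorphic sections of
`L ^ k = K ^ (k / 2)`, that are holomorphic outside of `A`. Such a section is given by its local
representing functions `f i`, functions of the coordinate `z_i` on `z_i (U_i)`, with
`f_j = f_i * (dz_j / dz_i) ^ (- k / 2)`. So that equal sections have equal representing functions,
`f i` takes the value `0` where it carries no information, that is, at the points of `A` and
outside of `z_i (U_i)`. -/
def Form (U : CoordCover X ι) (Θ : ThetaChar U) (A : Finset X) (k : ℤ) :
    Submodule ℂ (ι → ℂ → ℂ) where
  carrier := {f |
    (∀ i, DifferentiableOn ℂ (f i) (U.punctured A i)) ∧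
    (∀ i, ∀ z ∈ (U.chart i).target, MeromorphicAt (f i) z) ∧
    (∀ i, ∀ z ∉ U.punctured A i, f i z = 0) ∧
    (∀ i j, ∀ z ∈ (U.trans i j).source, f j (U.trans i j z) = f i z * Θ.g i j z ^ (-k))}
  add_mem' := by
    rintro f f' ⟨h1, h2, h3, h4⟩ ⟨h1', h2', h3', h4'⟩
    refine ⟨fun i => (h1 i).add (h1' i), fun i z hz => (h2 i z hz).add (h2' i z hz),
      fun i z hz => by simp [h3 i z hz, h3' i z hz], fun i j z hz => ?_⟩
    simp [h4 i j z hz, h4' i j z hz, add_mul]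
  zero_mem' := by
    refine ⟨fun i => differentiableOn_const 0, fun i z _ => MeromorphicAt.const 0 z,
      fun i z hz => rfl, fun i j z hz => by simp⟩
  smul_mem' := by
    rintro c f ⟨h1, h2, h3, h4⟩
    refine ⟨fun i => (h1 i).const_smul c,
      fun i z hz => (MeromorphicAt.const c z).smul (h2 i z hz),
      fun i z hz => by simp [h3 i z hz], fun i j z hz => ?_⟩
    simp [h4 i j z hz, mul_assoc]

variable {U : CoordCover X ι} {Θ : ThetaChar U} {A : Finset X}

theorem isOpen_punctured [T2Space X] (U : CoordCover X ι) (A : Finset X) (i : ι) :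
    IsOpen (U.punctured A i) :=
  (U.chart i).isOpen_inter_preimage_symm A.finite_toSet.isClosed.isOpen_compl

theorem trans_mem_punctured {i j : ι} {z : ℂ} (hz : z ∈ (U.trans i j).source)
    (hA : z ∈ U.punctured A i) : U.trans i j z ∈ U.punctured A j := by
  simp only [CoordCover.trans, OpenPartialHomeomorph.trans_source,
    OpenPartialHomeomorph.symm_source, Set.mem_inter_iff, Set.mem_preimage] at hz
  refine ⟨(U.chart j).map_source hz.2, ?_⟩
  have : (U.chart j).symm (U.trans i j z) = (U.chart i).symm z := (U.chart j).left_inv hz.2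
  rw [Set.mem_preimage, this]
  exact hA.2

theorem ThetaChar.g_ne_zero (Θ : ThetaChar U) {i j : ι} {z : ℂ}
    (hz : z ∈ (U.trans i j).source) : Θ.g i j z ≠ 0 := by
  have hz' := hz
  simp only [CoordCover.trans, OpenPartialHomeomorph.trans_source,
    OpenPartialHomeomorph.symm_source, Set.mem_inter_iff, Set.mem_preimage] at hz
  have hii : (U.trans i i).source = (U.chart i).target := by
    ext w
    simp only [CoordCover.trans, OpenPartialHomeomorph.trans_source,
      OpenPartialHomeomorph.symm_source, Set.mem_inter_iff, Set.mem_preimage]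
    exact ⟨fun h => h.1, fun h => ⟨h, (U.chart i).map_target h⟩⟩
  have hz1 : z ∈ (U.trans i i).source := hii ▸ hz.1
  have hid : (U.trans i i : ℂ → ℂ) =ᶠ[𝓝 z] id := by
    filter_upwards [(U.chart i).open_target.mem_nhds hz.1] with w hw
    exact (U.chart i).right_inv hw
  have h1 : Θ.g i i z ^ 2 = 1 := by rw [Θ.sq i i z hz1, hid.deriv_eq, deriv_id]
  have h2 := Θ.cocycle i j i z hz' hz1
  intro h0
  rw [h2, h0] at h1
  simp at h1

/-- The product of the representing functions is again that of a form; the weights add up. -/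
theorem mul_mem {k l m : ℤ} (hm : m = k + l) {s t : ι → ℂ → ℂ}
    (hs : s ∈ Form U Θ A k) (ht : t ∈ Form U Θ A l) :
    (fun i z => s i z * t i z) ∈ Form U Θ A m := by
  obtain ⟨h1, h2, h3, h4⟩ := hs
  obtain ⟨h1', h2', h3', h4'⟩ := ht
  refine ⟨fun i => (h1 i).mul (h1' i), fun i z hz => (h2 i z hz).mul (h2' i z hz),
      fun i z hz => by simp [h3 i z hz], fun i j z hz => ?_⟩
  have hg := Θ.g_ne_zero hz
  have : -m = -k + -l := by omega
  simp only [h4 i j z hz, h4' i j z hz, this, zpow_add₀ hg]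
  ring

/-- How the derivatives of the representing functions transform. -/
theorem deriv_trans [T2Space X] {k : ℤ} {s : ι → ℂ → ℂ} (hs : s ∈ Form U Θ A k) {i j : ι} {z : ℂ}
    (hz : z ∈ (U.trans i j).source) (hA : z ∈ U.punctured A i) :
    deriv (s j) (U.trans i j z) * Θ.g i j z ^ 2 =
      deriv (s i) z * Θ.g i j z ^ (-k)
        + s i z * ((-k : ℤ) * Θ.g i j z ^ (-k - 1) * deriv (Θ.g i j) z) := by
  obtain ⟨h1, -, -, h4⟩ := hs
  have hg := Θ.g_ne_zero hz
  have hd : deriv (U.trans i j) z ≠ 0 := by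
    rw [← Θ.sq i j z hz]; exact pow_ne_zero _ hg
  have hsrc : (U.trans i j).source ∈ 𝓝 z := (U.trans i j).open_source.mem_nhds hz
  have ht : HasDerivAt (U.trans i j) (deriv (U.trans i j) z) z :=
    (differentiableAt_of_deriv_ne_zero hd).hasDerivAt
  have hsj : HasDerivAt (s j) (deriv (s j) (U.trans i j z)) (U.trans i j z) :=
    ((h1 j).differentiableAt ((isOpen_punctured U A j).mem_nhds
      (trans_mem_punctured hz hA))).hasDerivAt
  have hsi : HasDerivAt (s i) (deriv (s i) z) z :=
    ((h1 i).differentiableAt ((isOpen_punctured U A i).mem_nhds hA)).hasDerivAt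
  have hgd : HasDerivAt (Θ.g i j) (deriv (Θ.g i j) z) z :=
    ((Θ.holo i j).differentiableAt hsrc).hasDerivAt
  have hL := hsj.comp z ht
  have hR := hsi.mul ((hasDerivAt_zpow (-k) (Θ.g i j z) (Or.inl hg)).comp z hgd)
  have heq : (s j ∘ U.trans i j) =ᶠ[𝓝 z] (s i * ((fun w => w ^ (-k)) ∘ Θ.g i j)) := by
    filter_upwards [hsrc] with w hw
    exact h4 i j w hw
  have := (hL.congr_of_eventuallyEq heq.symm).unique hR
  rw [Θ.sq i j z hz, this]
  rfl

/-- The bracket of a form of weight `k / 2` and one of weight `l / 2` is a form of weight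
`k / 2 + l / 2 + 1`. -/
theorem lie_mem [T2Space X] {k l m : ℤ} (hm : m = k + l + 2) {s t : ι → ℂ → ℂ}
    (hs : s ∈ Form U Θ A k) (ht : t ∈ Form U Θ A l) :
    (fun i z => -((k : ℂ) / 2) * s i z * deriv (t i) z + ((l : ℂ) / 2) * t i z * deriv (s i) z) ∈
      Form U Θ A m := by
  have hs' := hs
  have ht' := ht
  obtain ⟨h1, h2, h3, h4⟩ := hs
  obtain ⟨h1', h2', h3', h4'⟩ := ht
  refine ⟨fun i => ?_, fun i z hz => ?_, fun i z hz => by simp [h3 i z hz, h3' i z hz],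
    fun i j z hz => ?_⟩
  · have hO := isOpen_punctured U A i
    exact (((h1 i).const_mul _).mul ((h1' i).deriv hO)).add
      (((h1' i).const_mul _).mul ((h1 i).deriv hO))
  · exact (((MeromorphicAt.const _ z).mul (h2 i z hz)).mul (h2' i z hz).deriv).add
      (((MeromorphicAt.const _ z).mul (h2' i z hz)).mul (h2 i z hz).deriv)
  · by_cases hA : z ∈ U.punctured A i
    · have hg := Θ.g_ne_zero hz
      have e1 := deriv_trans hs' hz hA
      have e2 := deriv_trans ht' hz hA
      have hg2 : Θ.g i j z ^ 2 ≠ 0 := pow_ne_zero _ hg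
      rw [← mul_left_inj' hg2]
      have lhs : (-((k : ℂ) / 2) * s j (U.trans i j z) * deriv (t j) (U.trans i j z)
          + ((l : ℂ) / 2) * t j (U.trans i j z) * deriv (s j) (U.trans i j z)) * Θ.g i j z ^ 2
          = -((k : ℂ) / 2) * s j (U.trans i j z) * (deriv (t j) (U.trans i j z) * Θ.g i j z ^ 2)
          + ((l : ℂ) / 2) * t j (U.trans i j z) *
            (deriv (s j) (U.trans i j z) * Θ.g i j z ^ 2) := by ring
      rw [lhs, e1, e2, h4 i j z hz, h4' i j z hz]
      have a1 : Θ.g i j z ^ (-k - 1) = Θ.g i j z ^ (-k) * (Θ.g i j z)⁻¹ := by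
        rw [zpow_sub₀ hg, zpow_one, div_eq_mul_inv]
      have a2 : Θ.g i j z ^ (-l - 1) = Θ.g i j z ^ (-l) * (Θ.g i j z)⁻¹ := by
        rw [zpow_sub₀ hg, zpow_one, div_eq_mul_inv]
      have a3 : Θ.g i j z ^ (-m) * Θ.g i j z ^ 2 = Θ.g i j z ^ (-k) * Θ.g i j z ^ (-l) := by
        rw [← zpow_natCast, ← zpow_add₀ hg, ← zpow_add₀ hg]
        congr 1
        push_cast
        omega
      rw [mul_assoc _ (Θ.g i j z ^ (-m)), a3, a1, a2]
      push_cast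
      ring
    · have hA' : U.trans i j z ∉ U.punctured A j := by
        intro h
        apply hA
        simp only [CoordCover.trans, OpenPartialHomeomorph.trans_source,
          OpenPartialHomeomorph.symm_source, Set.mem_inter_iff, Set.mem_preimage] at hz
        have : (U.chart j).symm (U.trans i j z) = (U.chart i).symm z :=
          (U.chart j).left_inv hz.2
        refine ⟨hz.1, ?_⟩
        have h2 := h.2
        rwa [Set.mem_preimage, this] at h2
      simp [h3 i z hA, h3' i z hA, h3 j _ hA', h3' j _ hA']

/-- The product `(s dz^(k/2)) · (t dz^(l/2)) = s t dz^((k + l)/2)` of forms. -/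
def Form.mul {k l : ℤ} (m : ℤ) (hm : m = k + l) (s : Form U Θ A k) (t : Form U Θ A l) :
    Form U Θ A m :=
  ⟨fun i z => s.1 i z * t.1 i z, mul_mem hm s.2 t.2⟩

/-- The bracket `[s dz^κ, t dz^ν] = (-κ s (dt/dz) + ν t (ds/dz)) dz^(κ + ν + 1)` of forms of the
weights `κ = k / 2` and `ν = l / 2`. -/
def Form.lie [T2Space X] {k l : ℤ} (m : ℤ) (hm : m = k + l + 2)
    (s : Form U Θ A k) (t : Form U Θ A l) : Form U Θ A m :=
  ⟨fun i z => -((k : ℂ) / 2) * s.1 i z * deriv (t.1 i) z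
      + ((l : ℂ) / 2) * t.1 i z * deriv (s.1 i) z, lie_mem hm s.2 t.2⟩

variable (U Θ A)

/-- The Krichever-Novikov vector field algebra: the vector fields are the forms of weight `-1`. -/
abbrev VectorField := Form U Θ A (-2)

/-- The forms of weight `-1/2`. -/
abbrev HalfForm := Form U Θ A (-1)

/-- The vector space underlying the Krichever-Novikov Lie superalgebra. -/
abbrev SuperAlg := VectorField U Θ A × HalfForm U Θ A

/-- The even part (`0`) and the odd part (`1`) of the Krichever-Novikov Lie superalgebra. -/
def parity (a : ZMod 2) : Submodule ℂ (SuperAlg U Θ A) :=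
  if a = 0 then Submodule.prod ⊤ ⊥ else Submodule.prod ⊥ ⊤

variable {U Θ A}

/-- The product `[(e, φ), (f, ψ)] = ([e, f] + φ · ψ, e . ψ - f . φ)`, with
`[e, f] = (e f' - f e') d/dz` and `e . ψ = (e ψ' - ψ e' / 2) dz^(-1/2)`. -/
def superBracket [T2Space X] (x y : SuperAlg U Θ A) : SuperAlg U Θ A :=
  (Form.lie (-2) (by norm_num) x.1 y.1 + Form.mul (-2) (by norm_num) x.2 y.2,
    Form.lie (-1) (by norm_num) x.1 y.2 - Form.lie (-1) (by norm_num) y.1 x.2)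

/-! ### Projective connections, curves, and the bilinear form -/

/-- The Schwarzian derivative `S(h) = h''' / h' - (3 / 2) (h'' / h')^2`. -/
def schwarzian (h : ℂ → ℂ) (z : ℂ) : ℂ :=
  iteratedDeriv 3 h z / deriv h z - 3 / 2 * (iteratedDeriv 2 h z / deriv h z) ^ 2

/-- Holomorphic projective connections: systems of holomorphic functions `R i` on `z_i (U_i)` with
`R_j(z_j) * (dz_j / dz_i)^2 = R_i(z_i) + S(z_j)`. -/
structure IsProjConn (U : CoordCover X ι) (R : ι → ℂ → ℂ) : Prop where
  holo : ∀ i, DifferentiableOn ℂ (R i) (U.chart i).target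
  trans : ∀ i j, ∀ z ∈ (U.trans i j).source,
    R j (U.trans i j z) * deriv (U.trans i j) z ^ 2 = R i z + schwarzian (U.trans i j) z

/-- A closed continuously differentiable curve `γ : [0, 1] → X` not meeting `A`. -/
structure IsClosedCurve (A : Finset X) (γ : ℝ → X) : Prop where
  contMDiffOn : ContMDiffOn 𝓘(ℝ, ℝ) 𝓘(ℝ, ℂ) 1 γ (Set.Icc 0 1)
  closed : γ 0 = γ 1
  avoids : ∀ t ∈ Set.Icc (0 : ℝ) 1, γ t ∉ A

/-- A choice of a coordinate around the point `p`. -/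
def CoordCover.indexAt (U : CoordCover X ι) (p : X) : ι := (U.exists_mem_source p).choose

/-- `(1 / 2πi) ∫_C w` for a differential `w = w_i dz_i` along a curve `C` with finitely many
components `C c : [0, 1] → X`. The integrand at `t` is `w_i(z_i(C c t)) * (z_i ∘ C c)'(t)`, where
`z_i` is any coordinate around `C c t`. -/
def cint {κ : Type*} [Fintype κ] (U : CoordCover X ι) (C : κ → ℝ → X) (w : ι → ℂ → ℂ) : ℂ :=
  (2 * Real.pi * Complex.I)⁻¹ * ∑ c, ∫ t in (0 : ℝ)..1,
    w (U.indexAt (C c t)) (U.chart (U.indexAt (C c t)) (C c t)) *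
      derivWithin (fun s => U.chart (U.indexAt (C c t)) (C c s)) (Set.Icc 0 1) t

/-- The local expressions `(1/2) (e''' f - e f''') - R (e' f - e f')`. -/
def evenIntegrand (R e f : ι → ℂ → ℂ) : ι → ℂ → ℂ := fun i z =>
  1 / 2 * (iteratedDeriv 3 (e i) z * f i z - e i z * iteratedDeriv 3 (f i) z)
    - R i z * (deriv (e i) z * f i z - e i z * deriv (f i) z)

/-- The local expressions `φ'' ψ + φ ψ'' - R φ ψ`. -/
def oddIntegrand (R φ ψ : ι → ℂ → ℂ) : ι → ℂ → ℂ := fun i z =>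
  iteratedDeriv 2 (φ i) z * ψ i z + φ i z * iteratedDeriv 2 (ψ i) z - R i z * φ i z * ψ i z

/-- The form `Φ_{C,R}`, on `x = (e, φ)` and `y = (f, ψ)`:
`Φ(x, y) = Φ(e, f) + Φ(e, ψ) + Φ(φ, f) + Φ(φ, ψ)`, where the two mixed terms are zero. -/
def superForm {κ : Type*} [Fintype κ] (C : κ → ℝ → X) (R : ι → ℂ → ℂ)
    (x y : SuperAlg U Θ A) : ℂ :=
  cint U C (evenIntegrand R x.1.1 y.1.1) - cint U C (oddIntegrand R x.2.1 y.2.1)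

end Basic

/-! ### Lie superalgebras, cocycles, and central extensions -/

/-- The sign `(-1)^(a b)`. -/
def sgn (a b : ZMod 2) : ℂ := (-1) ^ (a.val * b.val)

section Super

variable {V W : Type*} [AddCommGroup V] [Module ℂ V] [AddCommGroup W] [Module ℂ W]

/-- `m` is bilinear. -/
structure IsBilin (m : V → V → W) : Prop where
  add_left : ∀ x x' y, m (x + x') y = m x y + m x' y
  add_right : ∀ x y y', m x (y + y') = m x y + m x y'
  smul_left : ∀ (a : ℂ) x y, m (a • x) y = a • m x y
  smul_right : ∀ (a : ℂ) x y, m x (a • y) = a • m x y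

/-- The complex vector space `V = P 0 ⊕ P 1` is a Lie superalgebra with respect to `br`. -/
structure IsLieSuper (P : ZMod 2 → Submodule ℂ V) (br : V → V → V) : Prop where
  isCompl : IsCompl (P 0) (P 1)
  bilin : IsBilin br
  graded : ∀ a b, ∀ x ∈ P a, ∀ y ∈ P b, br x y ∈ P (a + b)
  skew : ∀ a b, ∀ x ∈ P a, ∀ y ∈ P b, br x y = -(sgn a b • br y x)
  jacobi : ∀ a b c, ∀ x ∈ P a, ∀ y ∈ P b, ∀ z ∈ P c,
    sgn a c • br x (br y z) + sgn b a • br y (br z x) + sgn c b • br z (br x y) = 0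

/-- `Φ` is an (even) Lie superalgebra 2-cocycle. -/
structure IsSuperCocycle (P : ZMod 2 → Submodule ℂ V) (br : V → V → V) (Φ : V → V → ℂ) :
    Prop where
  bilin : IsBilin Φ
  even : ∀ a b, a ≠ b → ∀ x ∈ P a, ∀ y ∈ P b, Φ x y = 0
  skew : ∀ a b, ∀ x ∈ P a, ∀ y ∈ P b, Φ x y = -(sgn a b * Φ y x)
  cocycle : ∀ a b c, ∀ x ∈ P a, ∀ y ∈ P b, ∀ z ∈ P c,
    sgn a c * Φ x (br y z) + sgn b a * Φ y (br z x) + sgn c b * Φ z (br x y) = 0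

/-- Two cochains are cohomologous if they differ by the coboundary of an (even) linear form. -/
def Cohomologous (P : ZMod 2 → Submodule ℂ V) (br : V → V → V) (Φ Φ' : V → V → ℂ) : Prop :=
  ∃ η : V →ₗ[ℂ] ℂ, (∀ x ∈ P 1, η x = 0) ∧ ∀ x y, Φ x y - Φ' x y = η (br x y)

/-- The bracket `[x̂, ŷ] = [x, y]^ + Φ(x, y) t`, `[t, ·] = [·, t] = 0` on `ℂ ⊕ V`, with `t = (1, 0)`
and `x̂ = (0, x)`. -/
def extBracket (br : V → V → V) (Φ : V → V → ℂ) (x y : ℂ × V) : ℂ × V :=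
  (Φ x.2 y.2, br x.2 y.2)

/-- The parity on `ℂ ⊕ V`, with `ℂ` in the even part. -/
def extParity (P : ZMod 2 → Submodule ℂ V) (a : ZMod 2) : Submodule ℂ (ℂ × V) :=
  Submodule.prod (if a = 0 then ⊤ else ⊥) (P a)

/-- `0 → ℂ → W → V → 0` is a central extension of the Lie superalgebra `V` by `ℂ`, with even
central element `j 1`. -/
structure IsCentralExt (P : ZMod 2 → Submodule ℂ V) (br : V → V → V)
    (Q : ZMod 2 → Submodule ℂ W) (br' : W → W → W) (j : ℂ →ₗ[ℂ] W) (π : W →ₗ[ℂ] V) : Prop where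
  base : IsLieSuper P br
  total : IsLieSuper Q br'
  injective : Function.Injective j
  exact : Function.Exact j π
  surjective : Function.Surjective π
  even : ∀ c, j c ∈ Q 0
  central : ∀ c w, br' (j c) w = 0 ∧ br' w (j c) = 0
  map_parity : ∀ a, ∀ w ∈ Q a, π w ∈ P a
  map_bracket : ∀ w w', π (br' w w') = br (π w) (π w')

end Super

end KN

end

/-!
Write a coordinate change as `z_j = h(z_i)` with `h' = g ^ 2`, where `g` is the transition function
of the theta characteristic, and put `q = g' / g`. In these terms the derivatives of a vector field
and of a half-form transform by explicit polynomials in `q`, `q'`, `q''` times powers of `g`, and the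
Schwarzian derivative of `h` is `2 (q' - q ^ 2)` (`schwarzian_trans`). With these formulas it is a
polynomial identity that the anomalous terms of `(e''' f - e f''') / 2` and of `φ'' ψ + φ ψ''` are
cancelled by those of the projective connection, so the integrands are differentials
(`evenIntegrand_mem`, `oddIntegrand_mem`).

The cocycle identity holds because the integrand in it is the differential of a global function
that is holomorphic outside of `A`, and such a differential has integral zero along closed curves
(`cint_deriv_eq_zero`). For three vector fields the function is `-1/2` times their Wronskian; for a
vector field and two half-forms it is `1/2` times
`e (φ'' ψ + φ ψ'' - 2 φ' ψ') + e' (φ ψ)' - e'' φ ψ` (`hasDerivAt_cocyclePrimitive`). The projective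
connection drops out of the identity. Invariance of the two functions under coordinate changes
is again a polynomial identity (`wronskian_mem`, `superWronskian_mem`).

Two projective connections differ by a quadratic differential `ρ`, and the two forms differ by the
integral of `ρ` contracted with the even part of the bracket (`cohomologous_superForm`). The Jacobi
identity of the superalgebra is a polynomial identity in the derivatives of the representing
functions, and the central extension is the general construction from a cocycle
(`isCentralExt_extBracket`).
-/

noncomputable section

namespace KN

/-! ### Derivatives of representing functions and coordinate changes -/

section Transformation

variable {X : Type*} [TopologicalSpace X] [ChartedSpace ℂ X] {ι : Type*}
variable {U : CoordCover X ι} {Θ : ThetaChar U} {A : Finset X}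

theorem mem_trans_source {i j : ι} {z : ℂ} :
    z ∈ (U.trans i j).source ↔
      z ∈ (U.chart i).target ∧ (U.chart i).symm z ∈ (U.chart j).source := by
  simp only [CoordCover.trans, OpenPartialHomeomorph.trans_source,
    OpenPartialHomeomorph.symm_source, Set.mem_inter_iff, Set.mem_preimage]

theorem mem_punctured_of_trans_mem {i j : ι} {z : ℂ} (hz : z ∈ (U.trans i j).source)
    (h : U.trans i j z ∈ U.punctured A j) : z ∈ U.punctured A i := by
  have hz' := mem_trans_source.1 hz
  have h2 := h.2
  have e : (U.chart j).symm (U.trans i j z) = (U.chart i).symm z := (U.chart j).left_inv hz'.2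
  rw [Set.mem_preimage, e] at h2
  exact ⟨hz'.1, h2⟩

/-- At the punctures the transformation rule of a form holds by the normalization to zero, so only
the points outside of `A` matter. -/
theorem mem_form_of_trans {k : ℤ} {s : ι → ℂ → ℂ}
    (h1 : ∀ i, DifferentiableOn ℂ (s i) (U.punctured A i))
    (h2 : ∀ i, ∀ z ∈ (U.chart i).target, MeromorphicAt (s i) z)
    (h3 : ∀ i, ∀ z ∉ U.punctured A i, s i z = 0)
    (h4 : ∀ i j, ∀ z ∈ (U.trans i j).source, z ∈ U.punctured A i →
      s j (U.trans i j z) = s i z * Θ.g i j z ^ (-k)) : s ∈ Form U Θ A k := by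
  refine ⟨h1, h2, h3, fun i j z hz => ?_⟩
  by_cases hA : z ∈ U.punctured A i
  · exact h4 i j z hz hA
  · rw [h3 i z hA, h3 j _ fun h => hA (mem_punctured_of_trans_mem hz h), zero_mul]

theorem Form.ext_punctured {k : ℤ} {s t : Form U Θ A k}
    (h : ∀ i, ∀ z ∈ U.punctured A i, s.1 i z = t.1 i z) : s = t := by
  refine Subtype.ext (funext fun i => funext fun z => ?_)
  by_cases hA : z ∈ U.punctured A i
  · exact h i z hA
  · rw [s.2.2.2.1 i z hA, t.2.2.2.1 i z hA]

theorem differentiableOn_iteratedDeriv {V : Set ℂ} (hV : IsOpen V) {s : ℂ → ℂ}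
    (hs : DifferentiableOn ℂ s V) (n : ℕ) : DifferentiableOn ℂ (iteratedDeriv n s) V := by
  induction n with
  | zero => simpa using hs
  | succ n ih => rw [iteratedDeriv_succ]; exact ih.deriv hV

theorem meromorphicAt_iteratedDeriv {s : ℂ → ℂ} {z : ℂ} (hs : MeromorphicAt s z) (n : ℕ) :
    MeromorphicAt (iteratedDeriv n s) z := by
  rw [iteratedDeriv_eq_iterate]; exact hs.iterated_deriv

/-- Holomorphic functions have all their iterated derivatives, each the derivative of the one
before. -/
theorem hasDerivAt_iteratedDeriv {V : Set ℂ} (hV : IsOpen V) {s : ℂ → ℂ}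
    (hs : DifferentiableOn ℂ s V) (n : ℕ) {z : ℂ} (hz : z ∈ V) :
    HasDerivAt (iteratedDeriv n s) (iteratedDeriv (n + 1) s z) z := by
  rw [iteratedDeriv_succ]
  exact ((differentiableOn_iteratedDeriv hV hs n).differentiableAt (hV.mem_nhds hz)).hasDerivAt

theorem differentiableOn_logDeriv (Θ : ThetaChar U) (i j : ι) :
    DifferentiableOn ℂ (logDeriv (Θ.g i j)) (U.trans i j).source :=
  ((Θ.holo i j).deriv (U.trans i j).open_source).div (Θ.holo i j) fun _ hz => Θ.g_ne_zero hz

theorem ThetaChar.hasDerivAt_g (Θ : ThetaChar U) {i j : ι} {z : ℂ}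
    (hz : z ∈ (U.trans i j).source) :
    HasDerivAt (Θ.g i j) (Θ.g i j z * logDeriv (Θ.g i j) z) z := by
  have h := ((Θ.holo i j).differentiableAt ((U.trans i j).open_source.mem_nhds hz)).hasDerivAt
  rwa [logDeriv_apply, mul_div_cancel₀ _ (Θ.g_ne_zero hz)]

theorem ThetaChar.hasDerivAt_trans (Θ : ThetaChar U) {i j : ι} {z : ℂ}
    (hz : z ∈ (U.trans i j).source) :
    HasDerivAt (U.trans i j) (Θ.g i j z ^ 2) z := by
  have hd : deriv (U.trans i j) z ≠ 0 := by
    rw [← Θ.sq i j z hz]; exact pow_ne_zero _ (Θ.g_ne_zero hz)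
  rw [Θ.sq i j z hz]
  exact (differentiableAt_of_deriv_ne_zero hd).hasDerivAt

/-- In terms of `q = g' / g`, the Schwarzian derivative of a coordinate change with derivative
`g ^ 2` is `2 (q' - q ^ 2)`. -/
theorem schwarzian_trans (Θ : ThetaChar U) {i j : ι} {z : ℂ} (hz : z ∈ (U.trans i j).source) :
    schwarzian (U.trans i j) z =
      2 * (deriv (logDeriv (Θ.g i j)) z - logDeriv (Θ.g i j) z ^ 2) := by
  have hg := Θ.g_ne_zero hz
  have hO := (U.trans i j).open_source
  have hq : HasDerivAt (logDeriv (Θ.g i j)) (deriv (logDeriv (Θ.g i j)) z) z :=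
    ((differentiableOn_logDeriv Θ i j).differentiableAt (hO.mem_nhds hz)).hasDerivAt
  have d1 : ∀ w ∈ (U.trans i j).source, deriv (U.trans i j) w = Θ.g i j w ^ 2 :=
    fun w hw => (Θ.hasDerivAt_trans hw).deriv
  have d2 : ∀ w ∈ (U.trans i j).source,
      iteratedDeriv 2 (U.trans i j) w = 2 * (Θ.g i j w ^ 2 * logDeriv (Θ.g i j) w) := by
    intro w hw
    rw [iteratedDeriv_succ, iteratedDeriv_one,
      (Filter.eventuallyEq_of_mem (hO.mem_nhds hw) d1).deriv_eq,
      ((Θ.hasDerivAt_g hw).fun_pow 2).deriv]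
    push_cast
    ring
  have d3 : iteratedDeriv 3 (U.trans i j) z = Θ.g i j z ^ 2 *
      (4 * logDeriv (Θ.g i j) z ^ 2 + 2 * deriv (logDeriv (Θ.g i j)) z) := by
    rw [iteratedDeriv_succ, (Filter.eventuallyEq_of_mem (hO.mem_nhds hz) d2).deriv_eq,
      ((((Θ.hasDerivAt_g hz).fun_pow 2).fun_mul hq).const_mul 2).deriv]
    push_cast
    ring
  rw [schwarzian, d1 z hz, d2 z hz, d3]
  field_simp
  ring

theorem vectorField_trans {e : ι → ℂ → ℂ} (he : e ∈ Form U Θ A (-2)) {i j : ι} {z : ℂ}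
    (hz : z ∈ (U.trans i j).source) : e j (U.trans i j z) = e i z * Θ.g i j z ^ 2 := by
  simpa using he.2.2.2 i j z hz

theorem halfForm_trans {φ : ι → ℂ → ℂ} (hφ : φ ∈ Form U Θ A (-1)) {i j : ι} {z : ℂ}
    (hz : z ∈ (U.trans i j).source) : φ j (U.trans i j z) = φ i z * Θ.g i j z := by
  simpa using hφ.2.2.2 i j z hz

variable [T2Space X]

theorem Form.contDiffAt {k : ℤ} {s : ι → ℂ → ℂ} (hs : s ∈ Form U Θ A k) {i : ι} {z : ℂ}
    (hz : z ∈ U.punctured A i) {n : WithTop ℕ∞} : ContDiffAt ℂ n (s i) z :=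
  ((hs.1 i).contDiffOn (isOpen_punctured U A i)).contDiffAt
    ((isOpen_punctured U A i).mem_nhds hz)

theorem Form.hasDerivAt_iteratedDeriv {k : ℤ} {s : ι → ℂ → ℂ} (hs : s ∈ Form U Θ A k) {i : ι} {z : ℂ}
    (hz : z ∈ U.punctured A i) (n : ℕ) :
    HasDerivAt (iteratedDeriv n (s i)) (iteratedDeriv (n + 1) (s i) z) z :=
  KN.hasDerivAt_iteratedDeriv (isOpen_punctured U A i) (hs.1 i) n hz

theorem Form.hasDerivAt {k : ℤ} {s : ι → ℂ → ℂ} (hs : s ∈ Form U Θ A k) {i : ι} {z : ℂ}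
    (hz : z ∈ U.punctured A i) : HasDerivAt (s i) (deriv (s i) z) z :=
  ((hs.1 i).differentiableAt ((isOpen_punctured U A i).mem_nhds hz)).hasDerivAt

theorem Form.hasDerivAt_deriv {k : ℤ} {s : ι → ℂ → ℂ} (hs : s ∈ Form U Θ A k) {i : ι} {z : ℂ}
    (hz : z ∈ U.punctured A i) : HasDerivAt (deriv (s i)) (iteratedDeriv 2 (s i) z) z := by
  simpa using Form.hasDerivAt_iteratedDeriv hs hz 1

/-- If `Q` corresponds to `P g ^ m` under the coordinate change, where `g ^ 2` is its derivative,
then `Q'` corresponds to `(P' + m q P) g ^ (m - 2)`, where `q = g' / g`. -/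
theorem deriv_trans_zpow (Θ : ThetaChar U) {i j : ι} {z : ℂ} {Q P : ℂ → ℂ} {P' : ℂ} {m : ℤ}
    (hz : z ∈ (U.trans i j).source) (hA : z ∈ U.punctured A i)
    (hQ : DifferentiableOn ℂ Q (U.punctured A j)) (hP : HasDerivAt P P' z)
    (heq : ∀ w ∈ (U.trans i j).source, w ∈ U.punctured A i →
      Q (U.trans i j w) = P w * Θ.g i j w ^ m) :
    deriv Q (U.trans i j z) =
      (P' + m * logDeriv (Θ.g i j) z * P z) * Θ.g i j z ^ (m - 2) := by
  have hg := Θ.g_ne_zero hz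
  have hL := ((hQ.differentiableAt ((isOpen_punctured U A j).mem_nhds
      (trans_mem_punctured hz hA))).hasDerivAt).comp z (Θ.hasDerivAt_trans hz)
  have hR := hP.mul ((hasDerivAt_zpow m (Θ.g i j z) (Or.inl hg)).comp z (Θ.hasDerivAt_g hz))
  have he : (Q ∘ U.trans i j) =ᶠ[𝓝 z] (P * ((fun w => w ^ m) ∘ Θ.g i j)) := by
    filter_upwards [(U.trans i j).open_source.mem_nhds hz,
      (isOpen_punctured U A i).mem_nhds hA] with w hw hw'
    exact heq w hw hw'
  have := (hL.congr_of_eventuallyEq he.symm).unique hR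
  rw [← mul_left_inj' (pow_ne_zero 2 hg), this]
  simp only [Function.comp, zpow_sub₀ hg, zpow_ofNat]
  field_simp

section VectorField

variable {e : ι → ℂ → ℂ} (he : e ∈ Form U Θ A (-2)) {i j : ι} {z : ℂ}
  (hz : z ∈ (U.trans i j).source) (hA : z ∈ U.punctured A i)

include he hz hA

theorem deriv_vectorField_trans :
    deriv (e j) (U.trans i j z) = deriv (e i) z + 2 * logDeriv (Θ.g i j) z * e i z := by
  have hd := Form.hasDerivAt he hA
  have := deriv_trans_zpow (m := 2) Θ hz hA (he.1 j) hd
    fun w hw _ => by simpa using he.2.2.2 i j w hw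
  simpa using this

theorem iteratedDeriv_two_vectorField_trans :
    iteratedDeriv 2 (e j) (U.trans i j z) =
      (iteratedDeriv 2 (e i) z + 2 * (logDeriv (Θ.g i j) z * deriv (e i) z
        + deriv (logDeriv (Θ.g i j)) z * e i z)) * Θ.g i j z ^ (-2 : ℤ) := by
  have hd0 := Form.hasDerivAt he hA
  have hd1 := Form.hasDerivAt_deriv he hA
  have hq := ((differentiableOn_logDeriv Θ i j).differentiableAt
    ((U.trans i j).open_source.mem_nhds hz)).hasDerivAt
  have := deriv_trans_zpow (m := 0) Θ hz hA ((he.1 j).deriv (isOpen_punctured U A j))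
    (hd1.add ((hq.const_mul 2).mul hd0))
    fun w hw hw' => by simpa using deriv_vectorField_trans he hw hw'
  rw [iteratedDeriv_succ, iteratedDeriv_one, this]
  norm_num
  left
  ring

theorem iteratedDeriv_three_vectorField_trans :
    iteratedDeriv 3 (e j) (U.trans i j z) =
      (iteratedDeriv 3 (e i) z
        + 4 * (deriv (logDeriv (Θ.g i j)) z - logDeriv (Θ.g i j) z ^ 2) * deriv (e i) z
        + 2 * (iteratedDeriv 2 (logDeriv (Θ.g i j)) z
          - 2 * logDeriv (Θ.g i j) z * deriv (logDeriv (Θ.g i j)) z) * e i z)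
        * Θ.g i j z ^ (-4 : ℤ) := by
  have hd0 := Form.hasDerivAt he hA
  have hd1 := Form.hasDerivAt_deriv he hA
  have hd2 := Form.hasDerivAt_iteratedDeriv he hA 2
  have hO := (U.trans i j).open_source
  have hq := ((differentiableOn_logDeriv Θ i j).differentiableAt (hO.mem_nhds hz)).hasDerivAt
  have hq1 := by simpa using hasDerivAt_iteratedDeriv hO (differentiableOn_logDeriv Θ i j) 1 hz
  have := deriv_trans_zpow (m := -2) Θ hz hA
    (differentiableOn_iteratedDeriv (isOpen_punctured U A j) (he.1 j) 2)
    (hd2.add (((hq.mul hd1).add (hq1.mul hd0)).const_mul 2))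
    fun w hw hw' => iteratedDeriv_two_vectorField_trans he hw hw'
  rw [iteratedDeriv_succ, this]
  norm_num
  left
  ring

end VectorField

section HalfForm

variable {φ : ι → ℂ → ℂ} (hφ : φ ∈ Form U Θ A (-1)) {i j : ι} {z : ℂ}
  (hz : z ∈ (U.trans i j).source) (hA : z ∈ U.punctured A i)

include hφ hz hA

theorem deriv_halfForm_trans :
    deriv (φ j) (U.trans i j z) =
      (deriv (φ i) z + logDeriv (Θ.g i j) z * φ i z) * Θ.g i j z ^ (-1 : ℤ) := by
  have hd := Form.hasDerivAt hφ hA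
  have := deriv_trans_zpow (m := 1) Θ hz hA (hφ.1 j) hd
    fun w hw _ => by simpa using hφ.2.2.2 i j w hw
  simpa using this

theorem iteratedDeriv_two_halfForm_trans :
    iteratedDeriv 2 (φ j) (U.trans i j z) =
      (iteratedDeriv 2 (φ i) z
        + (deriv (logDeriv (Θ.g i j)) z - logDeriv (Θ.g i j) z ^ 2) * φ i z)
        * Θ.g i j z ^ (-3 : ℤ) := by
  have hd0 := Form.hasDerivAt hφ hA
  have hd1 := Form.hasDerivAt_deriv hφ hA
  have hq := ((differentiableOn_logDeriv Θ i j).differentiableAt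
    ((U.trans i j).open_source.mem_nhds hz)).hasDerivAt
  have := deriv_trans_zpow (m := -1) Θ hz hA ((hφ.1 j).deriv (isOpen_punctured U A j))
    (hd1.add (hq.mul hd0)) fun w hw hw' => deriv_halfForm_trans hφ hw hw'
  rw [iteratedDeriv_succ, iteratedDeriv_one, this]
  norm_num
  left
  ring

end HalfForm

end Transformation

/-! ### Differentials and functions built from vector fields and half-forms -/

section Differentials

variable {X : Type*} [TopologicalSpace X] [ChartedSpace ℂ X] {ι : Type*}
variable {U : CoordCover X ι} {Θ : ThetaChar U} {A : Finset X}

theorem projConn_trans (Θ : ThetaChar U) {R : ι → ℂ → ℂ} (hR : IsProjConn U R) {i j : ι} {z : ℂ}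
    (hz : z ∈ (U.trans i j).source) :
    R j (U.trans i j z) = (R i z + 2 * (deriv (logDeriv (Θ.g i j)) z - logDeriv (Θ.g i j) z ^ 2)) *
      Θ.g i j z ^ (-4 : ℤ) := by
  have hg := Θ.g_ne_zero hz
  have h := hR.trans i j z hz
  rw [schwarzian_trans Θ hz, ← Θ.sq i j z hz, ← pow_mul] at h
  rw [← h, zpow_neg, zpow_ofNat, mul_assoc, mul_inv_cancel₀ (pow_ne_zero _ hg), mul_one]

theorem differentiableOn_projConn {R : ι → ℂ → ℂ} (hR : IsProjConn U R) (i : ι) :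
    DifferentiableOn ℂ (R i) (U.punctured A i) :=
  (hR.holo i).mono Set.inter_subset_left

theorem meromorphicAt_projConn {R : ι → ℂ → ℂ} (hR : IsProjConn U R) {i : ι} {z : ℂ}
    (hz : z ∈ (U.chart i).target) : MeromorphicAt (R i) z :=
  ((hR.holo i).analyticAt ((U.chart i).open_target.mem_nhds hz)).meromorphicAt

/-- The difference of two projective connections is a quadratic differential; its contraction with
a vector field is a differential. -/
theorem projConn_sub_mul_mem {R R' : ι → ℂ → ℂ} (hR : IsProjConn U R) (hR' : IsProjConn U R')
    {e : ι → ℂ → ℂ} (he : e ∈ Form U Θ A (-2)) :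
    (fun i z => (R' i z - R i z) * e i z) ∈ Form U Θ A 2 := by
  refine mem_form_of_trans (fun i => ?_) (fun i z hz => ?_) (fun i z hz => ?_)
    fun i j z hz hA => ?_
  · exact ((differentiableOn_projConn hR' i).sub (differentiableOn_projConn hR i)).mul (he.1 i)
  · exact ((meromorphicAt_projConn hR' hz).sub (meromorphicAt_projConn hR hz)).mul
      (he.2.1 i z hz)
  · simp [he.2.2.1 i z hz]
  · have hg := Θ.g_ne_zero hz
    rw [projConn_trans Θ hR hz, projConn_trans Θ hR' hz, vectorField_trans he hz]
    simp only [zpow_neg, zpow_ofNat]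
    field_simp
    ring

variable [T2Space X]

/-- The terms of `(e''' f - e f''') / 2` that contain `q` add up to the Schwarzian derivative times
`e' f - e f'`, which the projective connection absorbs. -/
theorem evenIntegrand_mem {R : ι → ℂ → ℂ} (hR : IsProjConn U R) {e f : ι → ℂ → ℂ}
    (he : e ∈ Form U Θ A (-2)) (hf : f ∈ Form U Θ A (-2)) :
    evenIntegrand R e f ∈ Form U Θ A 2 := by
  refine mem_form_of_trans (fun i => ?_) (fun i z hz => ?_) (fun i z hz => ?_)
    fun i j z hz hA => ?_
  · have hO := isOpen_punctured U A i
    have hi := fun {s} hs n => differentiableOn_iteratedDeriv (s := s) hO hs n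
    exact ((((hi (he.1 i) 3).mul (hf.1 i)).sub ((he.1 i).mul (hi (hf.1 i) 3))).const_mul _).sub
      ((differentiableOn_projConn hR i).mul
        ((((he.1 i).deriv hO).mul (hf.1 i)).sub ((he.1 i).mul ((hf.1 i).deriv hO))))
  · have me := he.2.1 i z hz
    have mf := hf.2.1 i z hz
    exact ((MeromorphicAt.const _ z).mul (((meromorphicAt_iteratedDeriv me 3).mul mf).sub
      (me.mul (meromorphicAt_iteratedDeriv mf 3)))).sub
        ((meromorphicAt_projConn hR hz).mul ((me.deriv.mul mf).sub (me.mul mf.deriv)))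
  · simp [evenIntegrand, he.2.2.1 i z hz, hf.2.2.1 i z hz]
  · have hg := Θ.g_ne_zero hz
    simp only [evenIntegrand]
    rw [projConn_trans Θ hR hz, vectorField_trans he hz, vectorField_trans hf hz,
      deriv_vectorField_trans he hz hA, deriv_vectorField_trans hf hz hA,
      iteratedDeriv_three_vectorField_trans he hz hA,
      iteratedDeriv_three_vectorField_trans hf hz hA]
    simp only [zpow_neg, zpow_ofNat]
    field_simp
    ring

/-- The terms of `φ'' ψ + φ ψ''` that contain `q` add up to the Schwarzian derivative times `φ ψ`,
which the projective connection absorbs. -/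
theorem oddIntegrand_mem {R : ι → ℂ → ℂ} (hR : IsProjConn U R) {φ ψ : ι → ℂ → ℂ}
    (hφ : φ ∈ Form U Θ A (-1)) (hψ : ψ ∈ Form U Θ A (-1)) :
    oddIntegrand R φ ψ ∈ Form U Θ A 2 := by
  refine mem_form_of_trans (fun i => ?_) (fun i z hz => ?_) (fun i z hz => ?_)
    fun i j z hz hA => ?_
  · have hi := fun {s} hs n =>
      differentiableOn_iteratedDeriv (s := s) (isOpen_punctured U A i) hs n
    exact (((hi (hφ.1 i) 2).mul (hψ.1 i)).add ((hφ.1 i).mul (hi (hψ.1 i) 2))).sub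
      (((differentiableOn_projConn hR i).mul (hφ.1 i)).mul (hψ.1 i))
  · have mφ := hφ.2.1 i z hz
    have mψ := hψ.2.1 i z hz
    exact (((meromorphicAt_iteratedDeriv mφ 2).mul mψ).add
      (mφ.mul (meromorphicAt_iteratedDeriv mψ 2))).sub
        (((meromorphicAt_projConn hR hz).mul mφ).mul mψ)
  · simp [oddIntegrand, hφ.2.2.1 i z hz, hψ.2.2.1 i z hz]
  · have hg := Θ.g_ne_zero hz
    simp only [oddIntegrand]
    rw [projConn_trans Θ hR hz, halfForm_trans hφ hz, halfForm_trans hψ hz,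
      iteratedDeriv_two_halfForm_trans hφ hz hA, iteratedDeriv_two_halfForm_trans hψ hz hA]
    simp only [zpow_neg, zpow_ofNat]
    field_simp
    ring

/-- The Wronskian of three vector fields, in local coordinates. As the vector fields have weight
`-1`, it has weight `3 * (-1) + (0 + 1 + 2) = 0`, that is, it is a function. -/
def wronskian (e f g : ι → ℂ → ℂ) : ι → ℂ → ℂ := fun i z =>
  e i z * (deriv (f i) z * iteratedDeriv 2 (g i) z - deriv (g i) z * iteratedDeriv 2 (f i) z)
    + f i z * (deriv (g i) z * iteratedDeriv 2 (e i) z - deriv (e i) z * iteratedDeriv 2 (g i) z)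
    + g i z * (deriv (e i) z * iteratedDeriv 2 (f i) z - deriv (f i) z * iteratedDeriv 2 (e i) z)

theorem wronskian_mem {e f g : ι → ℂ → ℂ} (he : e ∈ Form U Θ A (-2)) (hf : f ∈ Form U Θ A (-2))
    (hg : g ∈ Form U Θ A (-2)) : wronskian e f g ∈ Form U Θ A 0 := by
  refine mem_form_of_trans (fun i => ?_) (fun i z hz => ?_) (fun i z hz => ?_)
    fun i j z hz hA => ?_
  · have hO := isOpen_punctured U A i
    have hi := fun s hs => differentiableOn_iteratedDeriv (s := s) hO hs 2
    have key : ∀ {a b c : ℂ → ℂ}, DifferentiableOn ℂ a (U.punctured A i) →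
        DifferentiableOn ℂ b (U.punctured A i) → DifferentiableOn ℂ c (U.punctured A i) →
        DifferentiableOn ℂ (fun z => a z * (deriv b z * iteratedDeriv 2 c z
          - deriv c z * iteratedDeriv 2 b z)) (U.punctured A i) := fun ha hb hc =>
      ha.mul (((hb.deriv hO).mul (hi _ hc)).sub ((hc.deriv hO).mul (hi _ hb)))
    exact ((key (he.1 i) (hf.1 i) (hg.1 i)).add (key (hf.1 i) (hg.1 i) (he.1 i))).add
      (key (hg.1 i) (he.1 i) (hf.1 i))
  · have key : ∀ {a b c : ℂ → ℂ}, MeromorphicAt a z → MeromorphicAt b z → MeromorphicAt c z →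
        MeromorphicAt (fun z => a z * (deriv b z * iteratedDeriv 2 c z
          - deriv c z * iteratedDeriv 2 b z)) z := fun ha hb hc =>
      ha.mul ((hb.deriv.mul (meromorphicAt_iteratedDeriv hc 2)).sub
        (hc.deriv.mul (meromorphicAt_iteratedDeriv hb 2)))
    have me := he.2.1 i z hz
    have mf := hf.2.1 i z hz
    have mg := hg.2.1 i z hz
    exact ((key me mf mg).add (key mf mg me)).add (key mg me mf)
  · simp [wronskian, he.2.2.1 i z hz, hf.2.2.1 i z hz, hg.2.2.1 i z hz]
  · have hne := Θ.g_ne_zero hz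
    simp only [wronskian]
    rw [vectorField_trans he hz, vectorField_trans hf hz, vectorField_trans hg hz,
      deriv_vectorField_trans he hz hA, deriv_vectorField_trans hf hz hA,
      deriv_vectorField_trans hg hz hA, iteratedDeriv_two_vectorField_trans he hz hA,
      iteratedDeriv_two_vectorField_trans hf hz hA, iteratedDeriv_two_vectorField_trans hg hz hA]
    simp only [zpow_neg, zpow_ofNat, neg_zero]
    field_simp
    ring

theorem hasDerivAt_wronskian {e f g : ι → ℂ → ℂ} (he : e ∈ Form U Θ A (-2))
    (hf : f ∈ Form U Θ A (-2)) (hg : g ∈ Form U Θ A (-2)) {i : ι} {z : ℂ}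
    (hA : z ∈ U.punctured A i) :
    HasDerivAt (wronskian e f g i)
      (e i z * (deriv (f i) z * iteratedDeriv 3 (g i) z - deriv (g i) z * iteratedDeriv 3 (f i) z)
        + f i z * (deriv (g i) z * iteratedDeriv 3 (e i) z
          - deriv (e i) z * iteratedDeriv 3 (g i) z)
        + g i z * (deriv (e i) z * iteratedDeriv 3 (f i) z
          - deriv (f i) z * iteratedDeriv 3 (e i) z)) z := by
  have e0 := Form.hasDerivAt he hA
  have e1 := Form.hasDerivAt_deriv he hA
  have e2 := Form.hasDerivAt_iteratedDeriv he hA 2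
  have f0 := Form.hasDerivAt hf hA
  have f1 := Form.hasDerivAt_deriv hf hA
  have f2 := Form.hasDerivAt_iteratedDeriv hf hA 2
  have g0 := Form.hasDerivAt hg hA
  have g1 := Form.hasDerivAt_deriv hg hA
  have g2 := Form.hasDerivAt_iteratedDeriv hg hA 2
  refine (((e0.mul ((f1.mul g2).sub (g1.mul f2))).add
    (f0.mul ((g1.mul e2).sub (e1.mul g2)))).add
    (g0.mul ((e1.mul f2).sub (f1.mul e2)))).congr_deriv ?_
  simp only [Pi.mul_apply, Pi.sub_apply]
  ring

/-- The invariant trilinear differential operator from a vector field and two half-forms to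
functions, in local coordinates. -/
def superWronskian (e φ ψ : ι → ℂ → ℂ) : ι → ℂ → ℂ := fun i z =>
  e i z * (iteratedDeriv 2 (φ i) z * ψ i z + φ i z * iteratedDeriv 2 (ψ i) z
      - 2 * (deriv (φ i) z * deriv (ψ i) z))
    + (deriv (e i) z * (deriv (φ i) z * ψ i z + φ i z * deriv (ψ i) z)
      - iteratedDeriv 2 (e i) z * (φ i z * ψ i z))

theorem superWronskian_mem {e φ ψ : ι → ℂ → ℂ} (he : e ∈ Form U Θ A (-2))
    (hφ : φ ∈ Form U Θ A (-1)) (hψ : ψ ∈ Form U Θ A (-1)) :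
    superWronskian e φ ψ ∈ Form U Θ A 0 := by
  refine mem_form_of_trans (fun i => ?_) (fun i z hz => ?_) (fun i z hz => ?_)
    fun i j z hz hA => ?_
  · have hO := isOpen_punctured U A i
    have hi := fun s hs => differentiableOn_iteratedDeriv (s := s) hO hs 2
    have de := he.1 i
    have dφ := hφ.1 i
    have dψ := hψ.1 i
    exact (de.mul ((((hi _ dφ).mul dψ).add (dφ.mul (hi _ dψ))).sub
      (((dφ.deriv hO).mul (dψ.deriv hO)).const_mul 2))).add
      (((de.deriv hO).mul (((dφ.deriv hO).mul dψ).add (dφ.mul (dψ.deriv hO)))).sub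
        ((hi _ de).mul (dφ.mul dψ)))
  · have hi := fun (s : ℂ → ℂ) (hs : MeromorphicAt s z) => meromorphicAt_iteratedDeriv hs 2
    have me := he.2.1 i z hz
    have mφ := hφ.2.1 i z hz
    have mψ := hψ.2.1 i z hz
    exact (me.mul ((((hi _ mφ).mul mψ).add (mφ.mul (hi _ mψ))).sub
      ((MeromorphicAt.const 2 z).mul (mφ.deriv.mul mψ.deriv)))).add
      ((me.deriv.mul ((mφ.deriv.mul mψ).add (mφ.mul mψ.deriv))).sub
        ((hi _ me).mul (mφ.mul mψ)))
  · simp [superWronskian, he.2.2.1 i z hz, hφ.2.2.1 i z hz, hψ.2.2.1 i z hz]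
  · have hne := Θ.g_ne_zero hz
    simp only [superWronskian]
    rw [vectorField_trans he hz, halfForm_trans hφ hz, halfForm_trans hψ hz,
      deriv_vectorField_trans he hz hA, deriv_halfForm_trans hφ hz hA,
      deriv_halfForm_trans hψ hz hA, iteratedDeriv_two_vectorField_trans he hz hA,
      iteratedDeriv_two_halfForm_trans hφ hz hA, iteratedDeriv_two_halfForm_trans hψ hz hA]
    simp only [zpow_neg, zpow_ofNat, neg_zero]
    field_simp
    ring

theorem hasDerivAt_superWronskian {e φ ψ : ι → ℂ → ℂ} (he : e ∈ Form U Θ A (-2))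
    (hφ : φ ∈ Form U Θ A (-1)) (hψ : ψ ∈ Form U Θ A (-1)) {i : ι} {z : ℂ}
    (hA : z ∈ U.punctured A i) :
    HasDerivAt (superWronskian e φ ψ i)
      (e i z * (iteratedDeriv 3 (φ i) z * ψ i z - iteratedDeriv 2 (φ i) z * deriv (ψ i) z
          - deriv (φ i) z * iteratedDeriv 2 (ψ i) z + φ i z * iteratedDeriv 3 (ψ i) z)
        + 2 * deriv (e i) z * (iteratedDeriv 2 (φ i) z * ψ i z + φ i z * iteratedDeriv 2 (ψ i) z)
        - iteratedDeriv 3 (e i) z * (φ i z * ψ i z)) z := by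
  have e0 := Form.hasDerivAt he hA
  have e1 := Form.hasDerivAt_deriv he hA
  have e2 := Form.hasDerivAt_iteratedDeriv he hA 2
  have f0 := Form.hasDerivAt hφ hA
  have f1 := Form.hasDerivAt_deriv hφ hA
  have f2 := Form.hasDerivAt_iteratedDeriv hφ hA 2
  have g0 := Form.hasDerivAt hψ hA
  have g1 := Form.hasDerivAt_deriv hψ hA
  have g2 := Form.hasDerivAt_iteratedDeriv hψ hA 2
  refine ((e0.mul (((f2.mul g0).add (f0.mul g2)).sub ((f1.mul g1).const_mul 2))).add
    ((e1.mul ((f1.mul g0).add (f0.mul g1))).sub (e2.mul (f0.mul g0)))).congr_deriv ?_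
  simp only [Pi.mul_apply, Pi.sub_apply, Pi.add_apply]
  ring

end Differentials

/-! ### Integration of differentials along curves -/

section Integration

variable {X : Type*} [TopologicalSpace X] [ChartedSpace ℂ X] {ι : Type*}
variable {U : CoordCover X ι} {Θ : ThetaChar U} {A : Finset X}

theorem CoordCover.mem_source_indexAt (U : CoordCover X ι) (p : X) :
    p ∈ (U.chart (U.indexAt p)).source :=
  (U.exists_mem_source p).choose_spec

theorem chart_mem_trans_source {i j : ι} {p : X} (hi : p ∈ (U.chart i).source)
    (hj : p ∈ (U.chart j).source) : U.chart i p ∈ (U.trans i j).source := by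
  refine mem_trans_source.2 ⟨(U.chart i).map_source hi, ?_⟩
  rwa [(U.chart i).left_inv hi]

theorem trans_chart (U : CoordCover X ι) {i : ι} (j : ι) {p : X} (hi : p ∈ (U.chart i).source) :
    U.trans i j (U.chart i p) = U.chart j p :=
  congrArg (U.chart j) ((U.chart i).left_inv hi)

theorem chart_mem_punctured {i : ι} {p : X} (hi : p ∈ (U.chart i).source) (hp : p ∉ A) :
    U.chart i p ∈ U.punctured A i := by
  refine ⟨(U.chart i).map_source hi, ?_⟩
  rw [Set.mem_preimage, (U.chart i).left_inv hi]
  exact hp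

theorem IsClosedCurve.eventually_mem_source {γ : ℝ → X} (hγ : IsClosedCurve A γ) {j : ι} {t : ℝ}
    (ht : t ∈ Set.Icc (0 : ℝ) 1) (hj : γ t ∈ (U.chart j).source) :
    ∀ᶠ s in 𝓝[Set.Icc 0 1] t, γ s ∈ (U.chart j).source :=
  (hγ.contMDiffOn t ht).continuousWithinAt.preimage_mem_nhdsWithin
    ((U.chart j).open_source.mem_nhds hj)

/-- A curve that is continuously differentiable in the charts of the real manifold `X` is so in the
coordinates of the covering: these are holomorphic functions of the charts. -/
theorem IsClosedCurve.contDiffWithinAt_chart [IsManifold 𝓘(ℂ) ω X] {γ : ℝ → X}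
    (hγ : IsClosedCurve A γ) {j : ι} {t : ℝ}
    (ht : t ∈ Set.Icc (0 : ℝ) 1) (hj : γ t ∈ (U.chart j).source) :
    ContDiffWithinAt ℝ 1 (fun s => U.chart j (γ s)) (Set.Icc 0 1) t := by
  have h1 := hγ.contMDiffOn t ht
  have h2 := contMDiffOn_of_mem_maximalAtlas (U.mem_maximalAtlas j) _ hj
  rw [contMDiffWithinAt_iff] at h1 h2
  obtain ⟨hc, h1⟩ := h1
  have h2 := h2.2
  simp only [mfld_simps, chartAt_self_eq, Function.comp_def] at h1 h2
  have hsrc : (chartAt ℂ (γ t)).source ∈ 𝓝 (γ t) := (chartAt ℂ (γ t)).open_source.mem_nhds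
    (mem_chart_source ℂ (γ t))
  have ev := hc.preimage_mem_nhdsWithin hsrc
  have h3 : ContDiffAt ℂ ω (fun x => U.chart j ((chartAt ℂ (γ t)).symm x))
      (chartAt ℂ (γ t) (γ t)) := by
    refine h2.contDiffAt ((chartAt ℂ (γ t)).continuousAt_symm
      (mem_chart_target ℂ (γ t)) |>.preimage_mem_nhds ?_)
    rw [(chartAt ℂ (γ t)).left_inv (mem_chart_source ℂ (γ t))]
    exact (U.chart j).open_source.mem_nhds hj
  have h4 := ((h3.restrict_scalars ℝ).of_le (m := 1) le_top).comp_contDiffWithinAt t h1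
  refine h4.congr_of_eventuallyEq ?_ ?_
  · filter_upwards [ev] with s hs
    exact congrArg (U.chart j) ((chartAt ℂ (γ t)).left_inv hs).symm
  · exact congrArg (U.chart j)
      ((chartAt ℂ (γ t)).left_inv (mem_chart_source ℂ (γ t))).symm

/-- The pullback of the differential `w_i dz_i` along `γ`, as a function on `[0, 1]`: the integrand
of `cint`. -/
def pullback (U : CoordCover X ι) (γ : ℝ → X) (w : ι → ℂ → ℂ) (t : ℝ) : ℂ :=
  w (U.indexAt (γ t)) (U.chart (U.indexAt (γ t)) (γ t)) *
    derivWithin (fun s => U.chart (U.indexAt (γ t)) (γ s)) (Set.Icc 0 1) t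

theorem cint_eq {κ : Type*} [Fintype κ] (C : κ → ℝ → X) (w : ι → ℂ → ℂ) :
    cint U C w = (2 * Real.pi * Complex.I)⁻¹ *
      ∑ c, ∫ t in (0 : ℝ)..1, pullback U (C c) w t := rfl

variable [IsManifold 𝓘(ℂ) ω X]

theorem IsClosedCurve.hasDerivWithinAt_chart {γ : ℝ → X}
    (hγ : IsClosedCurve A γ) {j : ι} {t : ℝ}
    (ht : t ∈ Set.Icc (0 : ℝ) 1) (hj : γ t ∈ (U.chart j).source) :
    HasDerivWithinAt (fun s => U.chart j (γ s))
      (derivWithin (fun s => U.chart j (γ s)) (Set.Icc 0 1) t) (Set.Icc 0 1) t :=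
  ((hγ.contDiffWithinAt_chart ht hj).differentiableWithinAt one_ne_zero).hasDerivWithinAt

/-- The pullback of a differential may be computed in any coordinate. -/
theorem pullback_eq {γ : ℝ → X} (hγ : IsClosedCurve A γ) {w : ι → ℂ → ℂ} (hw : w ∈ Form U Θ A 2)
    {t : ℝ} (ht : t ∈ Set.Icc (0 : ℝ) 1) {j : ι} (hj : γ t ∈ (U.chart j).source) :
    pullback U γ w t =
      w j (U.chart j (γ t)) * derivWithin (fun s => U.chart j (γ s)) (Set.Icc 0 1) t := by
  have hi := U.mem_source_indexAt (γ t)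
  rw [pullback]
  generalize U.indexAt (γ t) = i at hi ⊢
  have hz := chart_mem_trans_source hi hj
  have hg := Θ.g_ne_zero hz
  have ht' : HasDerivAt (U.trans i j) (Θ.g i j (U.chart i (γ t)) ^ 2) (U.chart i (γ t)) :=
    Θ.hasDerivAt_trans hz
  have hcomp := ht'.comp_hasDerivWithinAt t (hγ.hasDerivWithinAt_chart ht hi)
  have he : (fun s => U.chart j (γ s)) =ᶠ[𝓝[Set.Icc 0 1] t]
      (U.trans i j ∘ fun s => U.chart i (γ s)) := by
    filter_upwards [hγ.eventually_mem_source ht hi] with s hs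
    exact (trans_chart U j hs).symm
  have hd := hcomp.congr_of_eventuallyEq he (trans_chart U j hi).symm
  rw [hd.derivWithin (uniqueDiffOn_Icc zero_lt_one t ht), ← trans_chart U j hi,
    hw.2.2.2 i j _ hz, zpow_neg, zpow_ofNat]
  field_simp

variable [T2Space X]

theorem continuousOn_pullback {γ : ℝ → X} (hγ : IsClosedCurve A γ) {w : ι → ℂ → ℂ}
    (hw : w ∈ Form U Θ A 2) : ContinuousOn (pullback U γ w) (Set.Icc 0 1) := by
  intro t ht
  obtain ⟨j, hj⟩ := U.exists_mem_source (γ t)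
  have hc := hγ.contDiffWithinAt_chart ht hj
  have h1 := (hc.derivWithin (m := 0) (uniqueDiffOn_Icc zero_lt_one) (by simp)
    ht).continuousWithinAt
  have h2 : ContinuousWithinAt (fun s => w j (U.chart j (γ s))) (Set.Icc 0 1) t :=
    (Form.hasDerivAt hw
      (chart_mem_punctured hj (hγ.avoids t ht))).continuousAt.comp_continuousWithinAt
        (f := fun s => U.chart j (γ s)) hc.continuousWithinAt
  refine (h2.mul h1).congr_of_eventuallyEq ?_ (pullback_eq hγ hw ht hj)
  filter_upwards [hγ.eventually_mem_source ht hj, self_mem_nhdsWithin] with s hs hs'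
  exact pullback_eq hγ hw hs' hs

theorem intervalIntegrable_pullback {γ : ℝ → X} (hγ : IsClosedCurve A γ) {w : ι → ℂ → ℂ}
    (hw : w ∈ Form U Θ A 2) :
    IntervalIntegrable (pullback U γ w) MeasureTheory.volume 0 1 := by
  refine ContinuousOn.intervalIntegrable ?_
  rw [Set.uIcc_of_le zero_le_one]
  exact continuousOn_pullback hγ hw

variable {κ : Type*} [Fintype κ] {C : κ → ℝ → X}

/-- Additivity needs the forms to be continuous on the curves, for the integrals to exist. -/
theorem cint_add (hC : ∀ c, IsClosedCurve A (C c)) {w w' : ι → ℂ → ℂ}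
    (hw : w ∈ Form U Θ A 2) (hw' : w' ∈ Form U Θ A 2) :
    cint U C (w + w') = cint U C w + cint U C w' := by
  simp only [cint_eq]
  rw [← mul_add, ← Finset.sum_add_distrib]
  congr 1
  refine Finset.sum_congr rfl fun c _ => ?_
  rw [← intervalIntegral.integral_add (intervalIntegrable_pullback (hC c) hw)
    (intervalIntegrable_pullback (hC c) hw')]
  congr 1
  funext t
  simp [pullback, add_mul]

/-- The integral of the differential of a function along a closed curve vanishes. -/
theorem cint_deriv_eq_zero (hC : ∀ c, IsClosedCurve A (C c)) {F w : ι → ℂ → ℂ}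
    (hF : F ∈ Form U Θ A 0) (hw : w ∈ Form U Θ A 2)
    (h : ∀ i, ∀ z ∈ U.punctured A i, HasDerivAt (F i) (w i z) z) : cint U C w = 0 := by
  have key : ∀ c, ∫ t in (0 : ℝ)..1, pullback U (C c) w t = 0 := by
    intro c
    -- the local functions `F i` glue to a function on `X`, evaluated in the chosen coordinates
    set G : X → ℂ := fun p => F (U.indexAt p) (U.chart (U.indexAt p) p)
    have hGj : ∀ {j : ι} {p : X}, p ∈ (U.chart j).source → G p = F j (U.chart j p) := by
      intro j p hj
      have hi := U.mem_source_indexAt p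
      have := hF.2.2.2 _ j _ (chart_mem_trans_source hi hj)
      rw [trans_chart U j hi] at this
      simpa using this.symm
    have hd : ∀ t ∈ Set.Icc (0 : ℝ) 1, HasDerivWithinAt (fun s => G (C c s))
        (pullback U (C c) w t) (Set.Icc 0 1) t := by
      intro t ht
      obtain ⟨j, hj⟩ := U.exists_mem_source (C c t)
      have h1 := (h j _ (chart_mem_punctured hj ((hC c).avoids t ht))).comp_hasDerivWithinAt t
        ((hC c).hasDerivWithinAt_chart ht hj)
      rw [pullback_eq (hC c) hw ht hj]
      refine h1.congr_of_eventuallyEq ?_ (hGj hj)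
      filter_upwards [(hC c).eventually_mem_source ht hj] with s hs
      exact hGj hs
    rw [intervalIntegral.integral_eq_sub_of_hasDeriv_right_of_le (f := fun s => G (C c s))
      zero_le_one (fun t ht => (hd t ht).continuousWithinAt) (fun t ht => ?_)
      (intervalIntegrable_pullback (hC c) hw), (hC c).closed, sub_self]
    exact ((hd t (Set.Ioo_subset_Icc_self ht)).hasDerivAt
      (Icc_mem_nhds ht.1 ht.2)).hasDerivWithinAt
  simp [cint_eq, key]

end Integration

section IntegrationAlgebra

variable {X : Type*} [TopologicalSpace X] [ChartedSpace ℂ X] {ι : Type*}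
variable {U : CoordCover X ι} {κ : Type*} [Fintype κ] {C : κ → ℝ → X}

theorem cint_smul (a : ℂ) (w : ι → ℂ → ℂ) : cint U C (a • w) = a * cint U C w := by
  simp only [cint_eq, pullback, Pi.smul_apply, smul_eq_mul, mul_assoc,
    intervalIntegral.integral_const_mul]
  rw [← Finset.mul_sum]
  ring

end IntegrationAlgebra

/-! ### The Lie superalgebra -/

theorem isCompl_submodule_prod {V W : Type*} [AddCommGroup V] [Module ℂ V] [AddCommGroup W]
    [Module ℂ W] {p q : Submodule ℂ V} {p' q' : Submodule ℂ W} (h : IsCompl p q)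
    (h' : IsCompl p' q') : IsCompl (p.prod p') (q.prod q') :=
  IsCompl.of_eq (by rw [Submodule.prod_inf_prod, h.inf_eq_bot, h'.inf_eq_bot, Submodule.prod_bot])
    (by rw [Submodule.prod_sup_prod, h.sup_eq_top, h'.sup_eq_top, Submodule.prod_top])

section LieSuperalgebra

variable {X : Type*} [TopologicalSpace X] [ChartedSpace ℂ X] {ι : Type*}
variable {U : CoordCover X ι} {Θ : ThetaChar U} {A : Finset X}

theorem mem_parity_zero {x : SuperAlg U Θ A} : x ∈ parity U Θ A 0 ↔ x.2 = 0 := by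
  simp [parity, Submodule.mem_prod]

theorem mem_parity_one {x : SuperAlg U Θ A} : x ∈ parity U Θ A 1 ↔ x.1 = 0 := by
  simp [parity, Submodule.mem_prod]

theorem zmod_two_cases (a : ZMod 2) : a = 0 ∨ a = 1 := by
  revert a; decide

theorem sgn_zero_left (a : ZMod 2) : sgn 0 a = 1 := by simp [sgn]

theorem sgn_zero_right (a : ZMod 2) : sgn a 0 = 1 := by simp [sgn]

theorem sgn_one_one : sgn 1 1 = -1 := by simp [sgn, ZMod.val_one]

/-- A homogeneous element is a pair with a vanishing odd or even component. -/
theorem parity_cases {a : ZMod 2} {x : SuperAlg U Θ A} (hx : x ∈ parity U Θ A a) :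
    (a = 0 ∧ ∃ e, x = (e, 0)) ∨ (a = 1 ∧ ∃ φ, x = (0, φ)) := by
  rcases zmod_two_cases a with rfl | rfl
  · exact Or.inl ⟨rfl, x.1, Prod.ext rfl (mem_parity_zero.1 hx)⟩
  · exact Or.inr ⟨rfl, x.2, Prod.ext (mem_parity_one.1 hx) rfl⟩

theorem isCompl_parity : IsCompl (parity U Θ A 0) (parity U Θ A 1) := by
  simpa [parity] using isCompl_submodule_prod
    (isCompl_top_bot (α := Submodule ℂ (VectorField U Θ A)))
    (isCompl_bot_top (α := Submodule ℂ (HalfForm U Θ A)))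

theorem Form.zero_apply {k : ℤ} (i : ι) (z : ℂ) : (0 : Form U Θ A k).1 i z = 0 := rfl

theorem Form.add_apply {k : ℤ} (s t : Form U Θ A k) (i : ι) (z : ℂ) :
    (s + t).1 i z = s.1 i z + t.1 i z := rfl

theorem Form.smul_apply {k : ℤ} (a : ℂ) (s : Form U Θ A k) (i : ι) (z : ℂ) :
    (a • s).1 i z = a * s.1 i z := rfl

theorem Form.neg_apply {k : ℤ} (s : Form U Θ A k) (i : ι) (z : ℂ) :
    (-s).1 i z = -s.1 i z := rfl

theorem Form.deriv_zero {k : ℤ} (i : ι) (z : ℂ) : deriv ((0 : Form U Θ A k).1 i) z = 0 :=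
  deriv_const z 0

theorem Form.iteratedDeriv_zero {k : ℤ} (n : ℕ) (i : ι) (z : ℂ) :
    iteratedDeriv n ((0 : Form U Θ A k).1 i) z = 0 := by
  have : (0 : Form U Θ A k).1 i = fun _ => 0 := rfl
  rw [this, iteratedDeriv_const]
  simp

variable [T2Space X]

theorem Form.iteratedDeriv_add {k : ℤ} (s t : Form U Θ A k) (n : ℕ) {i : ι} {z : ℂ}
    (hz : z ∈ U.punctured A i) :
    iteratedDeriv n ((s + t).1 i) z = iteratedDeriv n (s.1 i) z + iteratedDeriv n (t.1 i) z :=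
  _root_.iteratedDeriv_add (Form.contDiffAt s.2 hz) (Form.contDiffAt t.2 hz)

theorem Form.iteratedDeriv_smul {k : ℤ} (a : ℂ) (s : Form U Θ A k) (n : ℕ) {i : ι} {z : ℂ}
    (hz : z ∈ U.punctured A i) :
    iteratedDeriv n ((a • s).1 i) z = a * iteratedDeriv n (s.1 i) z :=
  iteratedDeriv_const_mul a (Form.contDiffAt s.2 hz)

theorem Form.deriv_add {k : ℤ} (s t : Form U Θ A k) {i : ι} {z : ℂ}
    (hz : z ∈ U.punctured A i) :
    deriv ((s + t).1 i) z = deriv (s.1 i) z + deriv (t.1 i) z := by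
  simpa only [iteratedDeriv_one] using Form.iteratedDeriv_add s t 1 hz

theorem Form.deriv_smul {k : ℤ} (a : ℂ) (s : Form U Θ A k) {i : ι} {z : ℂ}
    (hz : z ∈ U.punctured A i) : deriv ((a • s).1 i) z = a * deriv (s.1 i) z := by
  simpa only [iteratedDeriv_one] using Form.iteratedDeriv_smul a s 1 hz

theorem superBracket_fst_apply (x y : SuperAlg U Θ A) (i : ι) (z : ℂ) :
    (superBracket x y).1.1 i z =
      x.1.1 i z * deriv (y.1.1 i) z - y.1.1 i z * deriv (x.1.1 i) z + x.2.1 i z * y.2.1 i z := by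
  change (-(((-2 : ℤ) : ℂ) / 2) * x.1.1 i z * deriv (y.1.1 i) z
      + (((-2 : ℤ) : ℂ) / 2) * y.1.1 i z * deriv (x.1.1 i) z) + x.2.1 i z * y.2.1 i z = _
  push_cast
  ring

theorem superBracket_snd_apply (x y : SuperAlg U Θ A) (i : ι) (z : ℂ) :
    (superBracket x y).2.1 i z =
      x.1.1 i z * deriv (y.2.1 i) z - 1 / 2 * y.2.1 i z * deriv (x.1.1 i) z
        - (y.1.1 i z * deriv (x.2.1 i) z - 1 / 2 * x.2.1 i z * deriv (y.1.1 i) z) := by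
  change (-(((-2 : ℤ) : ℂ) / 2) * x.1.1 i z * deriv (y.2.1 i) z
      + (((-1 : ℤ) : ℂ) / 2) * y.2.1 i z * deriv (x.1.1 i) z)
      - (-(((-2 : ℤ) : ℂ) / 2) * y.1.1 i z * deriv (x.2.1 i) z
      + (((-1 : ℤ) : ℂ) / 2) * x.2.1 i z * deriv (y.1.1 i) z) = _
  push_cast
  ring

theorem iteratedDeriv_succ_eq_of_eqOn {V : Set ℂ} (hV : IsOpen V) {n : ℕ} {s t : ℂ → ℂ} {t' z : ℂ}
    (h : ∀ w ∈ V, iteratedDeriv n s w = t w) (hz : z ∈ V) (ht : HasDerivAt t t' z) :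
    iteratedDeriv (n + 1) s z = t' := by
  rw [iteratedDeriv_succ, (Filter.eventuallyEq_of_mem (hV.mem_nhds hz) h).deriv_eq, ht.deriv]

section Derivatives

variable (x y : SuperAlg U Θ A) {i : ι} {z : ℂ} (hz : z ∈ U.punctured A i)

include hz

theorem deriv_superBracket_fst :
    deriv ((superBracket x y).1.1 i) z =
      x.1.1 i z * iteratedDeriv 2 (y.1.1 i) z - y.1.1 i z * iteratedDeriv 2 (x.1.1 i) z
        + (deriv (x.2.1 i) z * y.2.1 i z + x.2.1 i z * deriv (y.2.1 i) z) := by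
  have e0 := Form.hasDerivAt x.1.2 hz
  have e1 := Form.hasDerivAt_deriv x.1.2 hz
  have f0 := Form.hasDerivAt y.1.2 hz
  have f1 := Form.hasDerivAt_deriv y.1.2 hz
  have φ0 := Form.hasDerivAt x.2.2 hz
  have ψ0 := Form.hasDerivAt y.2.2 hz
  rw [← iteratedDeriv_one]
  refine iteratedDeriv_succ_eq_of_eqOn (isOpen_punctured U A i)
    (fun w _ => superBracket_fst_apply x y i w) hz
    ((((e0.fun_mul f1).fun_sub (f0.fun_mul e1)).fun_add (φ0.fun_mul ψ0)).congr_deriv ?_)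
  ring

theorem iteratedDeriv_two_superBracket_fst :
    iteratedDeriv 2 ((superBracket x y).1.1 i) z =
      x.1.1 i z * iteratedDeriv 3 (y.1.1 i) z + deriv (x.1.1 i) z * iteratedDeriv 2 (y.1.1 i) z
        - deriv (y.1.1 i) z * iteratedDeriv 2 (x.1.1 i) z
        - y.1.1 i z * iteratedDeriv 3 (x.1.1 i) z
        + (iteratedDeriv 2 (x.2.1 i) z * y.2.1 i z + 2 * (deriv (x.2.1 i) z * deriv (y.2.1 i) z)
          + x.2.1 i z * iteratedDeriv 2 (y.2.1 i) z) := by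
  have e0 := Form.hasDerivAt x.1.2 hz
  have e2 := Form.hasDerivAt_iteratedDeriv x.1.2 hz 2
  have f0 := Form.hasDerivAt y.1.2 hz
  have f2 := Form.hasDerivAt_iteratedDeriv y.1.2 hz 2
  have φ0 := Form.hasDerivAt x.2.2 hz
  have φ1 := Form.hasDerivAt_deriv x.2.2 hz
  have ψ0 := Form.hasDerivAt y.2.2 hz
  have ψ1 := Form.hasDerivAt_deriv y.2.2 hz
  refine iteratedDeriv_succ_eq_of_eqOn (isOpen_punctured U A i)
    (fun w hw => by rw [iteratedDeriv_one]; exact deriv_superBracket_fst x y hw) hz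
    ((((e0.fun_mul f2).fun_sub (f0.fun_mul e2)).fun_add
      ((φ1.fun_mul ψ0).fun_add (φ0.fun_mul ψ1))).congr_deriv ?_)
  ring

theorem iteratedDeriv_three_superBracket_fst :
    iteratedDeriv 3 ((superBracket x y).1.1 i) z =
      x.1.1 i z * iteratedDeriv 4 (y.1.1 i) z
        + 2 * (deriv (x.1.1 i) z * iteratedDeriv 3 (y.1.1 i) z)
        - 2 * (deriv (y.1.1 i) z * iteratedDeriv 3 (x.1.1 i) z)
        - y.1.1 i z * iteratedDeriv 4 (x.1.1 i) z
        + (iteratedDeriv 3 (x.2.1 i) z * y.2.1 i z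
          + 3 * (iteratedDeriv 2 (x.2.1 i) z * deriv (y.2.1 i) z)
          + 3 * (deriv (x.2.1 i) z * iteratedDeriv 2 (y.2.1 i) z)
          + x.2.1 i z * iteratedDeriv 3 (y.2.1 i) z) := by
  have e0 := Form.hasDerivAt x.1.2 hz
  have e1 := Form.hasDerivAt_deriv x.1.2 hz
  have e2 := Form.hasDerivAt_iteratedDeriv x.1.2 hz 2
  have e3 := Form.hasDerivAt_iteratedDeriv x.1.2 hz 3
  have f0 := Form.hasDerivAt y.1.2 hz
  have f1 := Form.hasDerivAt_deriv y.1.2 hz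
  have f2 := Form.hasDerivAt_iteratedDeriv y.1.2 hz 2
  have f3 := Form.hasDerivAt_iteratedDeriv y.1.2 hz 3
  have φ0 := Form.hasDerivAt x.2.2 hz
  have φ1 := Form.hasDerivAt_deriv x.2.2 hz
  have φ2 := Form.hasDerivAt_iteratedDeriv x.2.2 hz 2
  have ψ0 := Form.hasDerivAt y.2.2 hz
  have ψ1 := Form.hasDerivAt_deriv y.2.2 hz
  have ψ2 := Form.hasDerivAt_iteratedDeriv y.2.2 hz 2
  refine iteratedDeriv_succ_eq_of_eqOn (isOpen_punctured U A i)
    (fun w hw => iteratedDeriv_two_superBracket_fst x y hw) hz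
    ((((((e0.fun_mul f3).fun_add (e1.fun_mul f2)).fun_sub (f1.fun_mul e2)).fun_sub
      (f0.fun_mul e3)).fun_add (((φ2.fun_mul ψ0).fun_add
        ((φ1.fun_mul ψ1).const_mul 2)).fun_add (φ0.fun_mul ψ2))).congr_deriv ?_)
  ring

theorem deriv_superBracket_snd :
    deriv ((superBracket x y).2.1 i) z =
      x.1.1 i z * iteratedDeriv 2 (y.2.1 i) z + 1 / 2 * (deriv (x.1.1 i) z * deriv (y.2.1 i) z)
        - 1 / 2 * (y.2.1 i z * iteratedDeriv 2 (x.1.1 i) z)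
        - (y.1.1 i z * iteratedDeriv 2 (x.2.1 i) z + 1 / 2 * (deriv (y.1.1 i) z * deriv (x.2.1 i) z)
        - 1 / 2 * (x.2.1 i z * iteratedDeriv 2 (y.1.1 i) z)) := by
  have e0 := Form.hasDerivAt x.1.2 hz
  have e1 := Form.hasDerivAt_deriv x.1.2 hz
  have f0 := Form.hasDerivAt y.1.2 hz
  have f1 := Form.hasDerivAt_deriv y.1.2 hz
  have φ0 := Form.hasDerivAt x.2.2 hz
  have φ1 := Form.hasDerivAt_deriv x.2.2 hz
  have ψ0 := Form.hasDerivAt y.2.2 hz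
  have ψ1 := Form.hasDerivAt_deriv y.2.2 hz
  rw [← iteratedDeriv_one]
  refine iteratedDeriv_succ_eq_of_eqOn (isOpen_punctured U A i)
    (fun w _ => superBracket_snd_apply x y i w) hz
    ((((e0.fun_mul ψ1).fun_sub ((ψ0.const_mul (1 / 2)).fun_mul e1)).fun_sub
      ((f0.fun_mul φ1).fun_sub ((φ0.const_mul (1 / 2)).fun_mul f1))).congr_deriv ?_)
  ring

theorem iteratedDeriv_two_superBracket_snd :
    iteratedDeriv 2 ((superBracket x y).2.1 i) z =
      x.1.1 i z * iteratedDeriv 3 (y.2.1 i) z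
        + 3 / 2 * (deriv (x.1.1 i) z * iteratedDeriv 2 (y.2.1 i) z)
        - 1 / 2 * (y.2.1 i z * iteratedDeriv 3 (x.1.1 i) z)
        - (y.1.1 i z * iteratedDeriv 3 (x.2.1 i) z
        + 3 / 2 * (deriv (y.1.1 i) z * iteratedDeriv 2 (x.2.1 i) z)
        - 1 / 2 * (x.2.1 i z * iteratedDeriv 3 (y.1.1 i) z)) := by
  have e0 := Form.hasDerivAt x.1.2 hz
  have e1 := Form.hasDerivAt_deriv x.1.2 hz
  have e2 := Form.hasDerivAt_iteratedDeriv x.1.2 hz 2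
  have f0 := Form.hasDerivAt y.1.2 hz
  have f1 := Form.hasDerivAt_deriv y.1.2 hz
  have f2 := Form.hasDerivAt_iteratedDeriv y.1.2 hz 2
  have φ0 := Form.hasDerivAt x.2.2 hz
  have φ1 := Form.hasDerivAt_deriv x.2.2 hz
  have φ2 := Form.hasDerivAt_iteratedDeriv x.2.2 hz 2
  have ψ0 := Form.hasDerivAt y.2.2 hz
  have ψ1 := Form.hasDerivAt_deriv y.2.2 hz
  have ψ2 := Form.hasDerivAt_iteratedDeriv y.2.2 hz 2
  refine iteratedDeriv_succ_eq_of_eqOn (isOpen_punctured U A i)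
    (fun w hw => by rw [iteratedDeriv_one]; exact deriv_superBracket_snd x y hw) hz
    (((((e0.fun_mul ψ2).fun_add ((e1.fun_mul ψ1).const_mul (1 / 2))).fun_sub
      ((ψ0.fun_mul e2).const_mul (1 / 2))).fun_sub
      (((f0.fun_mul φ2).fun_add ((f1.fun_mul φ1).const_mul (1 / 2))).fun_sub
      ((φ0.fun_mul f2).const_mul (1 / 2)))).congr_deriv ?_)
  ring

end Derivatives

theorem isBilin_superBracket : IsBilin (superBracket (U := U) (Θ := Θ) (A := A)) := by
  constructor <;> intros <;> refine Prod.ext (Form.ext_punctured fun i z hz => ?_)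
    (Form.ext_punctured fun i z hz => ?_) <;>
  simp only [superBracket_fst_apply, superBracket_snd_apply, Prod.fst_add, Prod.snd_add,
    Prod.smul_fst, Prod.smul_snd, Form.add_apply, Form.smul_apply, Form.deriv_add _ _ hz,
    Form.deriv_smul _ _ hz] <;>
  ring

/-- The axioms are polynomial identities in the derivatives of the representing functions, checked
for each choice of parities. -/
theorem isLieSuper_superBracket : IsLieSuper (parity U Θ A) superBracket where
  isCompl := isCompl_parity
  bilin := isBilin_superBracket
  graded a b x hx y hy := by
    rcases parity_cases hx with ⟨rfl, e, rfl⟩ | ⟨rfl, φ, rfl⟩ <;>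
    rcases parity_cases hy with ⟨rfl, f, rfl⟩ | ⟨rfl, ψ, rfl⟩ <;>
    first
    | refine mem_parity_zero.2 (Form.ext_punctured fun i z _ => ?_)
      simp only [superBracket_snd_apply, Form.zero_apply, Form.deriv_zero]
      ring
    | refine mem_parity_one.2 (Form.ext_punctured fun i z _ => ?_)
      simp only [superBracket_fst_apply, Form.zero_apply, Form.deriv_zero]
      ring
  skew a b x hx y hy := by
    rcases parity_cases hx with ⟨rfl, e, rfl⟩ | ⟨rfl, φ, rfl⟩ <;>
    rcases parity_cases hy with ⟨rfl, f, rfl⟩ | ⟨rfl, ψ, rfl⟩ <;>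
    refine Prod.ext (Form.ext_punctured fun i z _ => ?_)
      (Form.ext_punctured fun i z _ => ?_) <;>
    simp only [sgn_zero_left, sgn_zero_right, sgn_one_one, Prod.fst_neg, Prod.snd_neg,
      Prod.smul_fst, Prod.smul_snd, Form.neg_apply, Form.smul_apply, superBracket_fst_apply,
      superBracket_snd_apply, Form.zero_apply, Form.deriv_zero] <;>
    ring
  jacobi a b c x hx y hy z hz := by
    rcases parity_cases hx with ⟨rfl, e, rfl⟩ | ⟨rfl, φ, rfl⟩ <;>
    rcases parity_cases hy with ⟨rfl, f, rfl⟩ | ⟨rfl, ψ, rfl⟩ <;>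
    rcases parity_cases hz with ⟨rfl, g, rfl⟩ | ⟨rfl, χ, rfl⟩ <;>
    refine Prod.ext (Form.ext_punctured fun i w hw => ?_)
      (Form.ext_punctured fun i w hw => ?_) <;>
    simp only [sgn_zero_left, sgn_zero_right, sgn_one_one, Prod.fst_add, Prod.snd_add,
      Prod.smul_fst, Prod.smul_snd, Prod.fst_zero, Prod.snd_zero, Form.add_apply,
      Form.smul_apply, superBracket_fst_apply, superBracket_snd_apply,
      deriv_superBracket_fst _ _ hw, deriv_superBracket_snd _ _ hw, Form.zero_apply,
      Form.deriv_zero, Form.iteratedDeriv_zero] <;>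
    ring

end LieSuperalgebra

/-! ### The cocycle -/

section Cocycle

variable {X : Type*} [TopologicalSpace X] [ChartedSpace ℂ X] {ι : Type*}
variable {U : CoordCover X ι} {Θ : ThetaChar U} {A : Finset X}

/-- The differential whose integral is the form `Φ_{C,R}`. -/
def superIntegrand (R : ι → ℂ → ℂ) (x y : SuperAlg U Θ A) : ι → ℂ → ℂ :=
  evenIntegrand R x.1.1 y.1.1 + (-1 : ℂ) • oddIntegrand R x.2.1 y.2.1

theorem superIntegrand_apply (R : ι → ℂ → ℂ) (x y : SuperAlg U Θ A) (i : ι) (z : ℂ) :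
    superIntegrand R x y i z =
      1 / 2 * (iteratedDeriv 3 (x.1.1 i) z * y.1.1 i z - x.1.1 i z * iteratedDeriv 3 (y.1.1 i) z)
      - R i z * (deriv (x.1.1 i) z * y.1.1 i z - x.1.1 i z * deriv (y.1.1 i) z)
      - (iteratedDeriv 2 (x.2.1 i) z * y.2.1 i z + x.2.1 i z * iteratedDeriv 2 (y.2.1 i) z
        - R i z * x.2.1 i z * y.2.1 i z) := by
  simp only [superIntegrand, evenIntegrand, oddIntegrand, Pi.add_apply, Pi.smul_apply, smul_eq_mul]
  ring

theorem eq_of_eqOn_punctured {k : ℤ} {s t : ι → ℂ → ℂ} (hs : s ∈ Form U Θ A k)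
    (ht : t ∈ Form U Θ A k) (h : ∀ i, ∀ z ∈ U.punctured A i, s i z = t i z) : s = t :=
  congrArg Subtype.val (Form.ext_punctured (s := ⟨s, hs⟩) (t := ⟨t, ht⟩) h)

theorem cint_eq_zero_of_forall {κ : Type*} [Fintype κ] {C : κ → ℝ → X} {w : ι → ℂ → ℂ}
    (h : ∀ i z, w i z = 0) : cint U C w = 0 := by
  simp [cint, h]

theorem evenIntegrand_zero_left (R : ι → ℂ → ℂ) (f : VectorField U Θ A) (i : ι) (z : ℂ) :
    evenIntegrand R (0 : VectorField U Θ A).1 f.1 i z = 0 := by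
  simp only [evenIntegrand, Form.zero_apply, Form.deriv_zero, Form.iteratedDeriv_zero]
  ring

theorem evenIntegrand_zero_right (R : ι → ℂ → ℂ) (e : VectorField U Θ A) (i : ι) (z : ℂ) :
    evenIntegrand R e.1 (0 : VectorField U Θ A).1 i z = 0 := by
  simp only [evenIntegrand, Form.zero_apply, Form.deriv_zero, Form.iteratedDeriv_zero]
  ring

theorem oddIntegrand_zero_left (R : ι → ℂ → ℂ) (ψ : HalfForm U Θ A) (i : ι) (z : ℂ) :
    oddIntegrand R (0 : HalfForm U Θ A).1 ψ.1 i z = 0 := by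
  simp only [oddIntegrand, Form.zero_apply, Form.iteratedDeriv_zero]
  ring

theorem oddIntegrand_zero_right (R : ι → ℂ → ℂ) (φ : HalfForm U Θ A) (i : ι) (z : ℂ) :
    oddIntegrand R φ.1 (0 : HalfForm U Θ A).1 i z = 0 := by
  simp only [oddIntegrand, Form.zero_apply, Form.iteratedDeriv_zero]
  ring

variable [T2Space X]

theorem superIntegrand_mem {R : ι → ℂ → ℂ} (hR : IsProjConn U R) (x y : SuperAlg U Θ A) :
    superIntegrand R x y ∈ Form U Θ A 2 :=
  Submodule.add_mem _ (evenIntegrand_mem hR x.1.2 y.1.2)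
    (Submodule.smul_mem _ _ (oddIntegrand_mem hR x.2.2 y.2.2))

variable [IsManifold 𝓘(ℂ) ω X]

section

variable {κ : Type*} [Fintype κ] {C : κ → ℝ → X} (hC : ∀ c, IsClosedCurve A (C c))
  {R : ι → ℂ → ℂ} (hR : IsProjConn U R)

include hC hR

theorem superForm_eq_cint (x y : SuperAlg U Θ A) :
    superForm C R x y = cint U C (superIntegrand R x y) := by
  rw [superIntegrand, cint_add hC (evenIntegrand_mem hR x.1.2 y.1.2)
    (Submodule.smul_mem _ _ (oddIntegrand_mem hR x.2.2 y.2.2)), cint_smul, superForm]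
  ring

theorem isBilin_superForm : IsBilin (superForm (U := U) (Θ := Θ) (A := A) C R) := by
  have hI := superIntegrand_mem (Θ := Θ) (A := A) hR
  constructor
  · intro x x' y
    simp only [superForm_eq_cint hC hR]
    rw [← cint_add hC (hI x y) (hI x' y)]
    congr 1
    refine eq_of_eqOn_punctured (hI _ _) (Submodule.add_mem _ (hI x y) (hI x' y)) fun i z hz => ?_
    simp only [Pi.add_apply, superIntegrand_apply, Prod.fst_add, Prod.snd_add, Form.add_apply,
      Form.deriv_add _ _ hz, Form.iteratedDeriv_add _ _ _ hz]
    ring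
  · intro x y y'
    simp only [superForm_eq_cint hC hR]
    rw [← cint_add hC (hI x y) (hI x y')]
    congr 1
    refine eq_of_eqOn_punctured (hI _ _) (Submodule.add_mem _ (hI x y) (hI x y')) fun i z hz => ?_
    simp only [Pi.add_apply, superIntegrand_apply, Prod.fst_add, Prod.snd_add, Form.add_apply,
      Form.deriv_add _ _ hz, Form.iteratedDeriv_add _ _ _ hz]
    ring
  · intro a x y
    simp only [superForm_eq_cint hC hR]
    rw [smul_eq_mul, ← cint_smul]
    congr 1
    refine eq_of_eqOn_punctured (hI _ _) (Submodule.smul_mem _ a (hI x y)) fun i z hz => ?_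
    simp only [Pi.smul_apply, smul_eq_mul, superIntegrand_apply, Prod.smul_fst, Prod.smul_snd,
      Form.smul_apply, Form.deriv_smul _ _ hz, Form.iteratedDeriv_smul _ _ _ hz]
    ring
  · intro a x y
    simp only [superForm_eq_cint hC hR]
    rw [smul_eq_mul, ← cint_smul]
    congr 1
    refine eq_of_eqOn_punctured (hI _ _) (Submodule.smul_mem _ a (hI x y)) fun i z hz => ?_
    simp only [Pi.smul_apply, smul_eq_mul, superIntegrand_apply, Prod.smul_fst, Prod.smul_snd,
      Form.smul_apply, Form.deriv_smul _ _ hz, Form.iteratedDeriv_smul _ _ _ hz]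
    ring

end

/-- The function whose differential is the integrand in the cocycle identity for three homogeneous
elements. The Wronskian serves three even elements, the other terms serve one even and two odd
ones; everything vanishes for the remaining parities. -/
def cocyclePrimitive (x y z : SuperAlg U Θ A) : ι → ℂ → ℂ :=
  (-1 / 2 : ℂ) • wronskian x.1.1 y.1.1 z.1.1 + (1 / 2 : ℂ) • (superWronskian x.1.1 y.2.1 z.2.1
    + superWronskian y.1.1 z.2.1 x.2.1 + superWronskian z.1.1 x.2.1 y.2.1)

omit [IsManifold 𝓘(ℂ) ω X] in
theorem cocyclePrimitive_mem (x y z : SuperAlg U Θ A) :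
    cocyclePrimitive x y z ∈ Form U Θ A 0 :=
  Submodule.add_mem _ (Submodule.smul_mem _ _ (wronskian_mem x.1.2 y.1.2 z.1.2))
    (Submodule.smul_mem _ _ (Submodule.add_mem _ (Submodule.add_mem _
      (superWronskian_mem x.1.2 y.2.2 z.2.2) (superWronskian_mem y.1.2 z.2.2 x.2.2))
      (superWronskian_mem z.1.2 x.2.2 y.2.2)))

omit [IsManifold 𝓘(ℂ) ω X] in
theorem hasDerivAt_cocyclePrimitive (R : ι → ℂ → ℂ) {a b c : ZMod 2} {x y z : SuperAlg U Θ A}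
    (hx : x ∈ parity U Θ A a) (hy : y ∈ parity U Θ A b) (hz : z ∈ parity U Θ A c)
    {i : ι} {w : ℂ} (hw : w ∈ U.punctured A i) :
    HasDerivAt (cocyclePrimitive x y z i)
      (sgn a c * superIntegrand R x (superBracket y z) i w
        + sgn b a * superIntegrand R y (superBracket z x) i w
        + sgn c b * superIntegrand R z (superBracket x y) i w) w := by
  have h := ((hasDerivAt_wronskian x.1.2 y.1.2 z.1.2 hw).const_smul (-1 / 2 : ℂ)).add
    ((((hasDerivAt_superWronskian x.1.2 y.2.2 z.2.2 hw).add
      (hasDerivAt_superWronskian y.1.2 z.2.2 x.2.2 hw)).add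
      (hasDerivAt_superWronskian z.1.2 x.2.2 y.2.2 hw)).const_smul (1 / 2 : ℂ))
  refine h.congr_deriv ?_
  simp only [superIntegrand_apply, superBracket_fst_apply, superBracket_snd_apply,
    deriv_superBracket_fst _ _ hw, iteratedDeriv_two_superBracket_snd _ _ hw,
    iteratedDeriv_three_superBracket_fst _ _ hw, smul_eq_mul]
  rcases parity_cases hx with ⟨rfl, e, rfl⟩ | ⟨rfl, φ, rfl⟩ <;>
  rcases parity_cases hy with ⟨rfl, f, rfl⟩ | ⟨rfl, ψ, rfl⟩ <;>
  rcases parity_cases hz with ⟨rfl, g, rfl⟩ | ⟨rfl, χ, rfl⟩ <;>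
  simp only [sgn_zero_left, sgn_zero_right, sgn_one_one, Form.zero_apply, Form.deriv_zero,
    Form.iteratedDeriv_zero] <;>
  ring

variable {κ : Type*} [Fintype κ] {C : κ → ℝ → X}

theorem isSuperCocycle_superForm (hC : ∀ c, IsClosedCurve A (C c)) {R : ι → ℂ → ℂ}
    (hR : IsProjConn U R) :
    IsSuperCocycle (parity U Θ A) superBracket (superForm C R) where
  bilin := isBilin_superForm hC hR
  even a b hab x hx y hy := by
    rw [superForm_eq_cint hC hR]
    refine cint_eq_zero_of_forall fun i z => ?_
    rcases parity_cases hx with ⟨rfl, e, rfl⟩ | ⟨rfl, φ, rfl⟩ <;>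
    rcases parity_cases hy with ⟨rfl, f, rfl⟩ | ⟨rfl, ψ, rfl⟩ <;>
    first
    | exact absurd rfl hab
    | simp only [superIntegrand_apply, Form.zero_apply, Form.deriv_zero, Form.iteratedDeriv_zero]
      ring
  skew a b x hx y hy := by
    rw [superForm_eq_cint hC hR, superForm_eq_cint hC hR, ← neg_mul, ← cint_smul]
    congr 1
    funext i z
    rcases parity_cases hx with ⟨rfl, e, rfl⟩ | ⟨rfl, φ, rfl⟩ <;>
    rcases parity_cases hy with ⟨rfl, f, rfl⟩ | ⟨rfl, ψ, rfl⟩ <;>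
    simp only [sgn_zero_left, sgn_zero_right, sgn_one_one, Pi.smul_apply, smul_eq_mul,
      superIntegrand_apply, Form.zero_apply, Form.deriv_zero, Form.iteratedDeriv_zero] <;>
    ring
  cocycle a b c x hx y hy z hz := by
    have hI := superIntegrand_mem (Θ := Θ) (A := A) hR
    have m1 := Submodule.smul_mem _ (sgn a c) (hI x (superBracket y z))
    have m2 := Submodule.smul_mem _ (sgn b a) (hI y (superBracket z x))
    have m3 := Submodule.smul_mem _ (sgn c b) (hI z (superBracket x y))
    have m12 := Submodule.add_mem _ m1 m2
    simp only [superForm_eq_cint hC hR, ← cint_smul]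
    rw [← cint_add hC m1 m2, ← cint_add hC m12 m3]
    exact cint_deriv_eq_zero hC (cocyclePrimitive_mem x y z) (Submodule.add_mem _ m12 m3)
      fun i w hw => hasDerivAt_cocyclePrimitive R hx hy hz hw

/-- The linear form is the integral of the contraction of a vector field with the quadratic
differential `R' - R`. -/
theorem cohomologous_superForm (hC : ∀ c, IsClosedCurve A (C c)) {R R' : ι → ℂ → ℂ}
    (hR : IsProjConn U R) (hR' : IsProjConn U R') :
    Cohomologous (parity U Θ A) superBracket (superForm C R') (superForm C R) := by
  have hmem := fun x : SuperAlg U Θ A => projConn_sub_mul_mem hR hR' x.1.2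
  let η : SuperAlg U Θ A →ₗ[ℂ] ℂ :=
    { toFun := fun x => cint U C fun i z => (R' i z - R i z) * x.1.1 i z
      map_add' := fun x y => by
        rw [← cint_add hC (hmem x) (hmem y)]
        congr 1
        funext i z
        exact mul_add _ _ _
      map_smul' := fun a x => by
        rw [RingHom.id_apply, smul_eq_mul, ← cint_smul]
        congr 1
        funext i z
        exact mul_left_comm _ _ _ }
  refine ⟨η, fun x hx => ?_, fun x y => ?_⟩
  · change cint U C (fun i z => (R' i z - R i z) * x.1.1 i z) = 0
    refine cint_eq_zero_of_forall fun i z => ?_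
    rw [mem_parity_one.1 hx, Form.zero_apply, mul_zero]
  · have h : superIntegrand R' x y =
        (fun i z => (R' i z - R i z) * (superBracket x y).1.1 i z) + superIntegrand R x y := by
      funext i z
      simp only [Pi.add_apply, superIntegrand_apply, superBracket_fst_apply]
      ring
    change _ = cint U C fun i z => (R' i z - R i z) * (superBracket x y).1.1 i z
    rw [superForm_eq_cint hC hR, superForm_eq_cint hC hR', h,
      cint_add hC (hmem (superBracket x y)) (superIntegrand_mem hR x y), add_sub_cancel_right]

end Cocycle

/-! ### Central extensions -/

section Extension

variable {V : Type*} [AddCommGroup V] [Module ℂ V]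

theorem mem_extParity {P : ZMod 2 → Submodule ℂ V} {a : ZMod 2} {x : ℂ × V} :
    x ∈ extParity P a ↔ (a ≠ 0 → x.1 = 0) ∧ x.2 ∈ P a := by
  by_cases h : a = 0 <;> simp [extParity, Submodule.mem_prod, h]

theorem isLieSuper_extBracket {P : ZMod 2 → Submodule ℂ V} {br : V → V → V} {Φ : V → V → ℂ}
    (h : IsLieSuper P br) (hΦ : IsSuperCocycle P br Φ) :
    IsLieSuper (extParity P) (extBracket br Φ) where
  isCompl := by
    simpa [extParity] using isCompl_submodule_prod (isCompl_top_bot (α := Submodule ℂ ℂ)) h.isCompl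
  bilin :=
    ⟨fun x x' y => Prod.ext (hΦ.bilin.add_left _ _ _) (h.bilin.add_left _ _ _),
      fun x y y' => Prod.ext (hΦ.bilin.add_right _ _ _) (h.bilin.add_right _ _ _),
      fun a x y => Prod.ext (hΦ.bilin.smul_left _ _ _) (h.bilin.smul_left _ _ _),
      fun a x y => Prod.ext (hΦ.bilin.smul_right _ _ _) (h.bilin.smul_right _ _ _)⟩
  graded a b x hx y hy := by
    rw [mem_extParity] at hx hy ⊢
    refine ⟨fun hab => hΦ.even a b (fun e => hab ?_) _ hx.2 _ hy.2, h.graded a b _ hx.2 _ hy.2⟩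
    rw [e, CharTwo.add_self_eq_zero]
  skew a b x hx y hy := Prod.ext
    (hΦ.skew a b _ (mem_extParity.1 hx).2 _ (mem_extParity.1 hy).2)
    (h.skew a b _ (mem_extParity.1 hx).2 _ (mem_extParity.1 hy).2)
  jacobi a b c x hx y hy z hz := Prod.ext
    (hΦ.cocycle a b c _ (mem_extParity.1 hx).2 _ (mem_extParity.1 hy).2 _ (mem_extParity.1 hz).2)
    (h.jacobi a b c _ (mem_extParity.1 hx).2 _ (mem_extParity.1 hy).2 _ (mem_extParity.1 hz).2)

theorem IsBilin.zero_left {W : Type*} [AddCommGroup W] [Module ℂ W] {m : V → V → W}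
    (h : IsBilin m) (y : V) : m 0 y = 0 := by
  simpa using h.smul_left 0 0 y

theorem IsBilin.zero_right {W : Type*} [AddCommGroup W] [Module ℂ W] {m : V → V → W}
    (h : IsBilin m) (x : V) : m x 0 = 0 := by
  simpa using h.smul_right 0 x 0

/-- An even 2-cocycle of a Lie superalgebra defines a central extension. -/
theorem isCentralExt_extBracket {P : ZMod 2 → Submodule ℂ V} {br : V → V → V} {Φ : V → V → ℂ}
    (h : IsLieSuper P br) (hΦ : IsSuperCocycle P br Φ) :
    IsCentralExt P br (extParity P) (extBracket br Φ) (LinearMap.inl ℂ ℂ V)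
      (LinearMap.snd ℂ ℂ V) where
  base := h
  total := isLieSuper_extBracket h hΦ
  injective := LinearMap.inl_injective
  exact := Function.Exact.inl_snd
  surjective := LinearMap.snd_surjective
  even _ := mem_extParity.2 ⟨fun h0 => absurd rfl h0, Submodule.zero_mem _⟩
  central _ _ := ⟨Prod.ext (hΦ.bilin.zero_left _) (h.bilin.zero_left _),
    Prod.ext (hΦ.bilin.zero_right _) (h.bilin.zero_right _)⟩
  map_parity _ _ hw := (mem_extParity.1 hw).2
  map_bracket _ _ := rfl

end Extension

end KN

end

open scoped Manifold ContDiff in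
theorem mainTheorem6
    {X : Type*} [TopologicalSpace X] [T2Space X] [CompactSpace X] [ConnectedSpace X]
    [ChartedSpace ℂ X] [IsManifold 𝓘(ℂ) ω X]
    {ι : Type*} (U : KN.CoordCover X ι) (Θ : KN.ThetaChar U) (A : Finset X)
    {κ : Type*} [Fintype κ] (C : κ → ℝ → X) (hC : ∀ c, KN.IsClosedCurve A (C c))
    (R : ι → ℂ → ℂ) (hR : KN.IsProjConn U R) :
    -- the integrands are differentials, meromorphic and holomorphic outside of `A`
    (∀ e f : KN.VectorField U Θ A, KN.evenIntegrand R e.1 f.1 ∈ KN.Form U Θ A 2) ∧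
    (∀ φ ψ : KN.HalfForm U Θ A, KN.oddIntegrand R φ.1 ψ.1 ∈ KN.Form U Θ A 2) ∧
    -- the values of the form
    (∀ e f : KN.VectorField U Θ A,
      KN.superForm C R ((e, 0) : KN.SuperAlg U Θ A) (f, 0) =
        KN.cint U C (KN.evenIntegrand R e.1 f.1)) ∧
    (∀ φ ψ : KN.HalfForm U Θ A,
      KN.superForm C R ((0, φ) : KN.SuperAlg U Θ A) (0, ψ) =
        -KN.cint U C (KN.oddIntegrand R φ.1 ψ.1)) ∧
    (∀ (e : KN.VectorField U Θ A) (φ : KN.HalfForm U Θ A),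
      KN.superForm C R ((e, 0) : KN.SuperAlg U Θ A) (0, φ) = 0 ∧
        KN.superForm C R ((0, φ) : KN.SuperAlg U Θ A) (e, 0) = 0) ∧
    -- it is a cocycle
    KN.IsSuperCocycle (KN.parity U Θ A) KN.superBracket (KN.superForm C R) ∧
    -- it defines a central extension
    KN.IsCentralExt (KN.parity U Θ A) KN.superBracket
      (KN.extParity (KN.parity U Θ A)) (KN.extBracket KN.superBracket (KN.superForm C R))
      (LinearMap.inl ℂ ℂ (KN.SuperAlg U Θ A)) (LinearMap.snd ℂ ℂ (KN.SuperAlg U Θ A)) ∧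
    -- another projective connection gives a cohomologous cocycle
    (∀ R' : ι → ℂ → ℂ, KN.IsProjConn U R' →
      KN.Cohomologous (KN.parity U Θ A) (KN.superBracket (U := U) (Θ := Θ) (A := A))
        (KN.superForm C R') (KN.superForm C R)) := by
  have hcoc := KN.isSuperCocycle_superForm (Θ := Θ) hC hR
  refine ⟨fun e f => KN.evenIntegrand_mem hR e.2 f.2, fun φ ψ => KN.oddIntegrand_mem hR φ.2 ψ.2,
    fun e f => ?_, fun φ ψ => ?_, fun e φ => ⟨?_, ?_⟩, hcoc,
    KN.isCentralExt_extBracket KN.isLieSuper_superBracket hcoc,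
    fun R' hR' => KN.cohomologous_superForm hC hR hR'⟩
  · rw [KN.superForm, KN.cint_eq_zero_of_forall (KN.oddIntegrand_zero_left R 0), sub_zero]
  · rw [KN.superForm, KN.cint_eq_zero_of_forall (KN.evenIntegrand_zero_left R 0), zero_sub]
  · rw [KN.superForm, KN.cint_eq_zero_of_forall (KN.evenIntegrand_zero_right R e),
      KN.cint_eq_zero_of_forall (KN.oddIntegrand_zero_left R φ), sub_zero]
  · rw [KN.superForm, KN.cint_eq_zero_of_forall (KN.evenIntegrand_zero_left R e),
      KN.cint_eq_zero_of_forall (KN.oddIntegrand_zero_right R φ), sub_zero]
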